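/- Let $X$ be a diffeological space and $k\ge 0$ an integer. A plot of $X$ is a map $p:U\to X$ of the diffeology, $U$ open in some $\mathbb R^n$; a morphism of plots from $p:U\to X$ to $q:V\to X$ is a smooth map $f:U\to V$ with $q\circ f=p$. For $x\in X$ let $T_xX$ be the colimit, in real vector spaces, of the tangent spaces $T_0U$ over the category of pointed plots $p:(U,0)\to(X,x)$ and pointed smooth maps over $X$. A diffeological vector pseudo-bundle over $X$ is a smooth map $\pi:E\to X$ of diffeological spaces with a real vector space structure on each fibre such that fibrewise addition $E\times_XE\to E$, fibrewise scalar multiplication $\mathbb R\times E\to E$ and the zero section $X\to E$ are smooth. The dvsification of a diffeology on such a total space (with $\pi$ smooth) is the smallest larger diffeology that makes $\pi$ a diffeological vector pseudo-bundle. * $T^{\mathrm{dvs}}X\to X$ is $\coprod_{x}T_xX$ with the dvsification of the diffeology generated by the maps $Tp:TU\to\coprod_xT_xX$ induced by the plots $p:U\to X$. * For a diffeological vector pseudo-bundle $E$ over $X$, $\Lambda^kE\to X$ is the bundle with fibres $\Lambda^kE_x$ whose plots are, locally, the finite sums $\sum_i r_i\, q_{i,1}\wedge\dots\wedge q_{i,k}$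 with $r_i$ smooth real functions and $q_{i,j}$ plots of $E$ over a common plot of $X$. * $E^*\to X$ is the bundle whose fibre over $x$ is the space of smooth linear functionals on $E_x$; a map $c:U\to E^*$ is a plot if and only if $U\to X$ and the evaluation $U\times_XE\to\mathbb R$ are smooth. $\Gamma(E)$ is the vector space of smooth sections, with the subset diffeology of $C^\infty(X,E)$. * $T^kX\to X$ is the colimit, in the category of diffeological vector pseudo-bundles, of the bundles $\Lambda^kTU\to U$ over the category of plots $U\to X$ (with $\operatorname{colim}U$ identified with $X$), and $\iota_p:\Lambda^kTU\to T^kX$ are the canonical maps. * $\Omega^k(X)$ is the space of differential $k$-forms: families $\omega_p\in\Omega^k(U)$, one for each plot $p:U\to X$, with $f^*\omega_q=\omega_p$ for every morphism $f:p\to q$ of plots; it carries the diffeology of the limit of the spaces $\Omega^k(U)=C^\infty(U,\Lambda^k(\mathbb R^n)^*)$. * $X$ is filtered if for every $x\in X$ the category of pointed plots $(U,0)\to(X,x)$ and germs at $0$ of pointed smooth maps over $X$ is filtered. The bundle maps $\Lambda^kTp:\Lambda^kTU\to\Lambda^kT^{\mathrm{dvs}}X$ induce a bundle map $\rho:T^kX\to\Lambda^kT^{\mathrm{dvs}}X$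 over $X$ with $\rho\circ\iota_p=\Lambda^kTp$. Put $\widetilde\Omega^k(X)=\Gamma((\Lambda^kT^{\mathrm{dvs}}X)^*)$, and let $\phi:\widetilde\Omega^k(X)\to\Omega^k(X)$ be the map $$\phi(s)_p(u)(v_1,\dots,v_k)=s(p(u))\bigl(\rho(\iota_p(v_1\wedge\dots\wedge v_k))\bigr)\qquad(u\in U,\ v_1,\dots,v_k\in T_uU).$$ **Theorem.** Suppose that $k=0$, or $k=1$, or $X$ is filtered. Then 1. $\rho:T^kX\to\Lambda^kT^{\mathrm{dvs}}X$ is an isomorphism of diffeological vector pseudo-bundles over $X$; 2. the map $\Gamma((\Lambda^kT^{\mathrm{dvs}}X)^*)\to\Gamma((T^kX)^*)$, $s\mapsto(x\mapsto s(x)\circ\rho_x)$, is an isomorphism of diffeological vector spaces; 3. $\phi:\widetilde\Omega^k(X)\to\Omega^k(X)$ is an isomorphism of diffeological vector spaces. -/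

import Mathlib

open Diffeology TopologicalSpace
open scoped ContDiff Topology DirectSum

noncomputable section

namespace DVPB

universe u v w z

/-- The Euclidean space `ℝⁿ`. -/
abbrev Euc (n : ℕ) := EuclideanSpace ℝ (Fin n)

/-! ### Diffeologies -/

/-- The pullback diffeology along `f : Y → Z`: a map `c` into `Y` is a plot iff `f ∘ c` is a plot.
For injective `f` this is the subset diffeology. -/
@[reducible] def inducedDiffeology {Y : Type u} {Z : Type v} [DiffeologicalSpace Z] (f : Y → Z) :
    DiffeologicalSpace Y where
  plots n := {c : Euc n → Y | IsPlot (f ∘ c)}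
  constant_plots _ := isPlot_const
  plot_reparam hp hf := isPlot_reparam hp hf
  locality {_ p} hp := DiffeologicalSpace.locality (p := f ∘ p) fun x ↦
    let ⟨W, hW, hx, h⟩ := hp x
    ⟨W, hW, hx, fun hfW hf ↦ h hfW hf⟩

/-- The smallest diffeology on `Z` for which all the maps `f i : Y i → Z` are smooth. -/
@[reducible] def generatedDiffeology {ι : Type w} {Y : ι → Type u} {Z : Type v}
    [∀ i, DiffeologicalSpace (Y i)] (f : ∀ i, Y i → Z) : DiffeologicalSpace Z :=
  DiffeologicalSpace.generateFrom
    {c | ∃ (i : ι) (r : Euc c.1 → Y i), IsPlot r ∧ c.2 = f i ∘ r}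

/-- Open subsets of Euclidean spaces carry the subset diffeology. -/
instance instDiffeologyOpens {n : ℕ} (U : Opens (Euc n)) : DiffeologicalSpace U :=
  inducedDiffeology (Subtype.val : U → Euc n)

/-! ### Diffeological vector pseudo-bundles -/

section VPB

variable {B : Type u} [DiffeologicalSpace B]

/-- The total space `E = ∐ b, F b → B` of a family of real vector spaces, with a diffeology `d` on
`E`, is a diffeological vector pseudo-bundle: the projection `E → B`, the fibrewise addition
`E ×_B E → E`, the fibrewise scalar multiplication `ℝ × E → E` and the zero section `B → E` are
smooth. (A plot of `E` is written as `a ↦ ⟨q a, s a⟩` with `s a ∈ F (q a)`; a plot of `E ×_B E` is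
a pair of plots of `E` over the same `q`.) -/
structure IsVPB (F : B → Type v) [∀ b, AddCommGroup (F b)] [∀ b, Module ℝ (F b)]
    (d : DiffeologicalSpace (Σ b, F b)) : Prop where
  proj : DSmooth (Sigma.fst : (Σ b, F b) → B)
  add : ∀ {n : ℕ} (q : Euc n → B) (s t : ∀ a, F (q a)),
    IsPlot (fun a ↦ (⟨q a, s a⟩ : Σ b, F b)) → IsPlot (fun a ↦ (⟨q a, t a⟩ : Σ b, F b)) →
    IsPlot (fun a ↦ (⟨q a, s a + t a⟩ : Σ b, F b))
  smul : ∀ {n : ℕ} (q : Euc n → B) (r : Euc n → ℝ) (s : ∀ a, F (q a)),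
    IsPlot r → IsPlot (fun a ↦ (⟨q a, s a⟩ : Σ b, F b)) →
    IsPlot (fun a ↦ (⟨q a, r a • s a⟩ : Σ b, F b))
  zero : DSmooth (fun b ↦ (⟨b, 0⟩ : Σ b, F b))

/-- Dvsification: the smallest diffeology on the total space which contains the given one and
which makes the projection a diffeological vector pseudo-bundle. -/
@[reducible] def dvsify (F : B → Type v) [∀ b, AddCommGroup (F b)] [∀ b, Module ℝ (F b)]
    (d : DiffeologicalSpace (Σ b, F b)) : DiffeologicalSpace (Σ b, F b) :=
  sInf {d' | d ≤ d' ∧ IsVPB F d'}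

theorem isVPB_induced (F : B → Type v) [∀ b, AddCommGroup (F b)] [∀ b, Module ℝ (F b)] :
    IsVPB F (inducedDiffeology (Sigma.fst : (Σ b, F b) → B)) := by
  let _ := inducedDiffeology (Sigma.fst : (Σ b, F b) → B)
  exact ⟨fun n p hp ↦ hp, fun q s t hs _ ↦ hs, fun q r s _ hs ↦ hs, fun n p hp ↦ hp⟩

theorem isVPB_dvsify (F : B → Type v) [∀ b, AddCommGroup (F b)] [∀ b, Module ℝ (F b)]
    (d : DiffeologicalSpace (Σ b, F b)) (hd : DSmooth (Sigma.fst : (Σ b, F b) → B)) :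
    IsVPB F (dvsify F d) := by
  have key : ∀ (n : ℕ) (c : Euc n → Σ b, F b), @IsPlot _ (dvsify F d) n c ↔
      ∀ d', d ≤ d' → IsVPB F d' → @IsPlot _ d' n c := fun n c ↦ by
    rw [dvsify, DiffeologicalSpace.isPlot_sInf_iff]
    exact ⟨fun h d' h₁ h₂ ↦ h d' ⟨h₁, h₂⟩, fun h d' h' ↦ h d' h'.1 h'.2⟩
  constructor
  · intro n c hc
    exact (key n c).1 hc (inducedDiffeology Sigma.fst)
      (DiffeologicalSpace.le_iff'.2 fun m p hp ↦ hd m p hp) (isVPB_induced F)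
  · intro n q s t hs ht
    exact (key _ _).2 fun d' h₁ h₂ ↦
      h₂.add q s t ((key _ _).1 hs d' h₁ h₂) ((key _ _).1 ht d' h₁ h₂)
  · intro n q r s hr hs
    exact (key _ _).2 fun d' h₁ h₂ ↦ h₂.smul q r s hr ((key _ _).1 hs d' h₁ h₂)
  · intro n q hq
    exact (key _ _).2 fun d' h₁ h₂ ↦ h₂.zero n q hq

theorem dvsify_le (F : B → Type v) [∀ b, AddCommGroup (F b)] [∀ b, Module ℝ (F b)]
    {d d' : DiffeologicalSpace (Σ b, F b)} (h : d ≤ d') (h' : IsVPB F d') : dvsify F d ≤ d' :=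
  sInf_le ⟨h, h'⟩

theorem le_dvsify (F : B → Type v) [∀ b, AddCommGroup (F b)] [∀ b, Module ℝ (F b)]
    (d : DiffeologicalSpace (Σ b, F b)) : d ≤ dvsify F d :=
  le_sInf fun _ h ↦ h.1

theorem dSmooth_fst_generated {ι : Type w} {Y : ι → Type z} [∀ i, DiffeologicalSpace (Y i)]
    {F : B → Type v} (f : ∀ i, Y i → Σ b, F b) (hf : ∀ i, DSmooth (fun y ↦ (f i y).1)) :
    @DSmooth _ _ (generatedDiffeology f) _ (Sigma.fst : (Σ b, F b) → B) := by
  intro n c hc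
  exact hc (inducedDiffeology Sigma.fst) fun c' ⟨i, r, hr, h⟩ ↦ by
    change IsPlot (Sigma.fst ∘ c'.2)
    rw [h]
    exact hf i _ r hr

end VPB

/-- A diffeological vector pseudo-bundle over `B`. Its total space is `Σ b, E.fib b`. -/
structure VPB (B : Type u) [DiffeologicalSpace B] where
  fib : B → Type v
  [addCommGroup : ∀ b, AddCommGroup (fib b)]
  [module : ∀ b, Module ℝ (fib b)]
  diffeology : DiffeologicalSpace (Σ b, fib b)
  isVPB : IsVPB fib diffeology

namespace VPB

variable {B : Type u} [DiffeologicalSpace B]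

instance (E : VPB.{u, v} B) (b : B) : AddCommGroup (E.fib b) := E.addCommGroup b
instance (E : VPB.{u, v} B) (b : B) : Module ℝ (E.fib b) := E.module b

/-- The total space of a bundle. -/
def Total (E : VPB.{u, v} B) := Σ b, E.fib b

/-- The point of the total space given by a vector in the fibre over `b`. -/
def elt (E : VPB.{u, v} B) (b : B) (e : E.fib b) : E.Total := ⟨b, e⟩

instance (E : VPB.{u, v} B) : DiffeologicalSpace E.Total := E.diffeology

/-- The map of total spaces (over `B`) given by a family of linear maps of the fibres. -/
def totalMap {E : VPB.{u, v} B} {E' : VPB.{u, w} B} (f : ∀ b, E.fib b →ₗ[ℝ] E'.fib b) :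
    E.Total → E'.Total :=
  fun e ↦ E'.elt e.1 (f e.1 e.2)

/-- The fibrewise linear map `f : E → E'` over `B` is an isomorphism of diffeological vector
pseudo-bundles over `B`: it is smooth, and it has a two-sided inverse which is a smooth fibrewise
linear map over `B`. -/
def IsBundleIso {E : VPB.{u, v} B} {E' : VPB.{u, w} B} (f : ∀ b, E.fib b →ₗ[ℝ] E'.fib b) : Prop :=
  DSmooth (totalMap f) ∧ ∃ g : ∀ b, E'.fib b →ₗ[ℝ] E.fib b, DSmooth (totalMap g) ∧
    ∀ b, g b ∘ₗ f b = LinearMap.id ∧ f b ∘ₗ g b = LinearMap.id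

/-! #### Exterior powers -/

/-- The total space of the `k`-fold fibrewise product of `E` with itself. -/
def FibreProd (E : VPB.{u, v} B) (k : ℕ) := Σ b, (Fin k → E.fib b)

/-- A plot of `E ×_B ⋯ ×_B E` is a map whose projection to `B` and whose `k` components are
plots. -/
instance (E : VPB.{u, v} B) (k : ℕ) : DiffeologicalSpace (E.FibreProd k) :=
  inducedDiffeology (Sigma.fst : E.FibreProd k → B) ⊓
    ⨅ i : Fin k, inducedDiffeology (fun y : E.FibreProd k ↦ E.elt y.1 (y.2 i))

/-- The canonical map `E ×_B ⋯ ×_B E → Λᵏ E`, `(e₁, …, e_k) ↦ e₁ ∧ ⋯ ∧ e_k`. -/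
def wedge (E : VPB.{u, v} B) (k : ℕ) (y : E.FibreProd k) : Σ b, ⋀[ℝ]^k (E.fib b) :=
  ⟨y.1, exteriorPower.ιMulti ℝ k y.2⟩

/-- The exterior power `Λᵏ E → B`: the fibre over `b` is `Λᵏ E_b`, and the diffeology is the
dvsification of the one generated by `E ×_B ⋯ ×_B E → Λᵏ E`; that is, locally, plots are finite
sums `∑ i, r i • (q i 1 ∧ ⋯ ∧ q i k)` with smooth functions `r i` and plots `q i j` of `E` which
all lie over the same plot of `B`. (For `k = 0` this is `B × ℝ`, for `k = 1` it is `E`, up to the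
canonical isomorphisms `Λ⁰ V = ℝ` and `Λ¹ V = V`.) -/
abbrev exterior (E : VPB.{u, v} B) (k : ℕ) : VPB.{u, v} B where
  fib b := ⋀[ℝ]^k (E.fib b)
  diffeology := dvsify _ (generatedDiffeology (fun _ : Unit ↦ E.wedge k))
  isVPB := isVPB_dvsify _ _ <| dSmooth_fst_generated (fun _ : Unit ↦ E.wedge k) fun _ n c (hc : IsPlot c) ↦ by
    change IsPlot (Sigma.fst ∘ c)
    exact (DiffeologicalSpace.isPlot_inf_iff.1 hc).1

/-! #### Dual bundles -/

/-- The smooth linear functionals on the fibre `E_b`, which carries the subset diffeology. -/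
def smoothDual (E : VPB.{u, v} B) (b : B) : Submodule ℝ (E.fib b →ₗ[ℝ] ℝ) where
  carrier := {l | @DSmooth _ _ (inducedDiffeology (E.elt b)) _ l}
  add_mem' {l l'} hl hl' n p hp := by
    have h : ContDiff ℝ ∞ (l ∘ p) := isPlot_iff_contDiff.1 (hl n p hp)
    have h' : ContDiff ℝ ∞ (l' ∘ p) := isPlot_iff_contDiff.1 (hl' n p hp)
    exact isPlot_iff_contDiff.2 (h.add h')
  zero_mem' _ _ _ := isPlot_const
  smul_mem' r l hl n p hp := by
    have h : ContDiff ℝ ∞ (l ∘ p) := isPlot_iff_contDiff.1 (hl n p hp)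
    exact isPlot_iff_contDiff.2 (h.const_smul r)

/-- The diffeology of the dual bundle: `c : U → E*` is a plot iff `π ∘ c : U → B` and the
evaluation map `U ×_B E → ℝ` are smooth. (The plots of `U ×_B E` are the pairs of a smooth `g` and
a plot of `E` with the same image in `B`.) -/
@[reducible] def dualDiffeology (E : VPB.{u, v} B) :
    DiffeologicalSpace (Σ b, E.smoothDual b) where
  plots n := {c : Euc n → Σ b, E.smoothDual b | IsPlot (fun a ↦ (c a).1) ∧
    ∀ (m : ℕ) (g : Euc m → Euc n) (e : ∀ a, E.fib (c (g a)).1), ContDiff ℝ ∞ g →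
      IsPlot (fun a ↦ E.elt ((c (g a)).1) (e a)) →
      IsPlot (fun a ↦ (c (g a)).2.1 (e a))}
  constant_plots c := ⟨isPlot_const, fun m _ e _ he ↦ c.2.2 m e he⟩
  plot_reparam {n m p f} hp hf :=
    ⟨isPlot_reparam hp.1 hf, fun l g e hg he ↦ hp.2 l (f ∘ g) e (hf.comp hg) he⟩
  locality {n p} hp := by
    refine ⟨DiffeologicalSpace.locality fun x ↦ ?_, fun m g e hg he ↦
      DiffeologicalSpace.locality fun x ↦ ?_⟩
    · obtain ⟨W, hW, hx, h⟩ := hp x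
      exact ⟨W, hW, hx, fun hfW hf ↦ (h hfW hf).1⟩
    · obtain ⟨W, hW, hx, h⟩ := hp (g x)
      refine ⟨g ⁻¹' W, hW.preimage hg.continuous, hx, fun {l f} hfW hf ↦ ?_⟩
      exact (h (f := g ∘ f) hfW (hg.comp hf)).2 l id (fun a ↦ e (f a)) contDiff_id
        (isPlot_reparam he hf)

/-- The dual bundle `E* → B`, with fibre the smooth linear functionals on `E_b`. -/
abbrev dual (E : VPB.{u, v} B) : VPB.{u, v} B where
  fib b := E.smoothDual b
  diffeology := E.dualDiffeology
  isVPB := by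
    let _ := E.dualDiffeology
    refine ⟨fun n p hp ↦ hp.1, fun q s t hs ht ↦ ⟨hs.1, fun m g e hg he ↦ ?_⟩,
      fun q r s hr hs ↦ ⟨hs.1, fun m g e hg he ↦ ?_⟩, fun n p hp ↦ ⟨hp, fun m g e hg he ↦ ?_⟩⟩
    · exact isPlot_iff_contDiff.2 ((isPlot_iff_contDiff.1 (hs.2 m g e hg he)).add
        (isPlot_iff_contDiff.1 (ht.2 m g e hg he)))
    · exact isPlot_iff_contDiff.2 (((isPlot_iff_contDiff.1 hr).comp hg).mul
        (isPlot_iff_contDiff.1 (hs.2 m g e hg he)))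
    · exact isPlot_const

/-! #### Sections -/

/-- The vector space `Γ(E)` of smooth sections of `E → B`. -/
def sections (E : VPB.{u, v} B) : Submodule ℝ (∀ b, E.fib b) where
  carrier := {s | DSmooth (fun b ↦ E.elt b (s b))}
  add_mem' {s t} hs ht n p hp :=
    E.isVPB.add p (fun a ↦ s (p a)) (fun a ↦ t (p a)) (hs n p hp) (ht n p hp)
  zero_mem' := E.isVPB.zero
  smul_mem' r s hs n p hp :=
    E.isVPB.smul p (fun _ ↦ r) (fun a ↦ s (p a)) isPlot_const (hs n p hp)

/-- `Γ(E)` has the subset diffeology of the functional diffeology on `C^∞(B, E)`: `σ : U → Γ(E)`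
is a plot iff `U × B → E`, `(a, b) ↦ σ a b`, is smooth. -/
instance (E : VPB.{u, v} B) : DiffeologicalSpace E.sections where
  plots n := {σ : Euc n → E.sections | ∀ (m : ℕ) (f : Euc m → Euc n) (g : Euc m → B),
    ContDiff ℝ ∞ f → IsPlot g → IsPlot (fun a ↦ E.elt (g a) ((σ (f a)).1 (g a)))}
  constant_plots s m _ g _ hg := s.2 m g hg
  plot_reparam {n m p f} hp hf l h g hh hg := hp l (f ∘ h) g (hf.comp hh) hg
  locality {n p} hp m f g hf hg := DiffeologicalSpace.locality fun x ↦ by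
    obtain ⟨W, hW, hx, h⟩ := hp (f x)
    refine ⟨f ⁻¹' W, hW.preimage hf.continuous, hx, fun {l i} hi hi' ↦ ?_⟩
    exact h (f := f ∘ i) hi (hf.comp hi') l id (g ∘ i) contDiff_id (isPlot_reparam hg hi')

end VPB

/-! ### The plot category -/

/-- A plot `p : U → X` of `X` defined on an open subset `U` of a Euclidean space. -/
structure Plot (X : Type u) [DiffeologicalSpace X] where
  dim : ℕ
  dom : Opens (Euc dim)
  toFun : dom → X
  smooth : DSmooth toFun

/-- A morphism `p → q` of plots: a smooth map `f : U → V` of the domains with `q ∘ f = p`. It is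
given by a map of the ambient spaces, of which only the values on `U` matter. -/
structure Plot.Hom {X : Type u} [DiffeologicalSpace X] (p q : Plot X) where
  toFun : Euc p.dim → Euc q.dim
  contDiffOn : ContDiffOn ℝ ∞ toFun p.dom
  mapsTo : Set.MapsTo toFun p.dom q.dom
  comm : ∀ a : p.dom, q.toFun ⟨toFun a, mapsTo a.2⟩ = p.toFun a

/-- A pointed plot `p : (U, 0) → (X, x)`. -/
structure PtPlot {X : Type u} [DiffeologicalSpace X] (x : X) extends Plot X where
  zero_mem : 0 ∈ dom
  map_zero : toFun ⟨0, zero_mem⟩ = x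

/-- A plot `p : U → X` together with a point `a ∈ U` such that `p a = x`. -/
structure PlotAt {X : Type u} [DiffeologicalSpace X] (x : X) extends Plot X where
  pt : dom
  map_pt : toFun pt = x

/-! ### Filtered diffeological spaces -/

section Filtered

variable {X : Type u} [DiffeologicalSpace X]

/-- `f` represents a morphism `p → q` of the germ category of `(X, x)`: it is defined and smooth
near `0`, `f 0 = 0`, and `q ∘ f = p` near `0`. -/
def IsGermHom {x : X} (p q : PtPlot x) (f : Euc p.dim → Euc q.dim) : Prop :=
  (∀ᶠ a in 𝓝 0, ContDiffAt ℝ ∞ f a) ∧ f 0 = 0 ∧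
    ∀ᶠ a in 𝓝 0, ∃ (ha : a ∈ p.dom) (hfa : f a ∈ q.dom), q.toFun ⟨f a, hfa⟩ = p.toFun ⟨a, ha⟩

/-- The germ category of `(X, x)` is weakly filtered: every finite collection of pointed plots
factors, as germs, through a common pointed plot. -/
def IsWeaklyFilteredAt (x : X) : Prop :=
  ∀ (m : ℕ) (P : Fin m → PtPlot x), ∃ r : PtPlot x, ∀ i, ∃ f, IsGermHom (P i) r f

/-- The germ category of `(X, x)` is filtered: it is weakly filtered, and any two parallel
morphisms are coequalized, as germs, by some morphism. -/
def IsFilteredAt (x : X) : Prop :=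
  IsWeaklyFilteredAt x ∧ ∀ (p q : PtPlot x) (f g : Euc p.dim → Euc q.dim),
    IsGermHom p q f → IsGermHom p q g →
      ∃ (r : PtPlot x) (h : Euc q.dim → Euc r.dim), IsGermHom q r h ∧ h ∘ f =ᶠ[𝓝 0] h ∘ g

end Filtered

/-- `X` is a filtered diffeological space: all its germ categories are filtered. -/
def IsFilteredSpace (X : Type u) [DiffeologicalSpace X] : Prop :=
  ∀ x : X, IsFilteredAt x

/-! ### Colimits of vector spaces -/

section Colim

open Classical in
/-- The colimit of a diagram of real vector spaces `M i` is the direct sum of the `M i` modulo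
`v ∈ M i` being identified with `φ v ∈ M j` for the linear maps `φ ∈ A i j` of the diagram; this
is the subspace that is divided out. -/
def colimRel {ι : Type u} (M : ι → Type v) [∀ i, AddCommGroup (M i)] [∀ i, Module ℝ (M i)]
    (A : ∀ i j, Set (M i →ₗ[ℝ] M j)) : Submodule ℝ (⨁ i, M i) :=
  Submodule.span ℝ {z | ∃ i j, ∃ φ ∈ A i j, ∃ v : M i,
    z = DirectSum.lof ℝ ι M i v - DirectSum.lof ℝ ι M j (φ v)}

/-- The colimit of the diagram of the vector spaces `M i` and the linear maps `φ ∈ A i j`. -/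
abbrev VectColim {ι : Type u} (M : ι → Type v) [∀ i, AddCommGroup (M i)] [∀ i, Module ℝ (M i)]
    (A : ∀ i j, Set (M i →ₗ[ℝ] M j)) :=
  (⨁ i, M i) ⧸ colimRel M A

variable {ι : Type u} {M : ι → Type v} [∀ i, AddCommGroup (M i)] [∀ i, Module ℝ (M i)]
  {A : ∀ i j, Set (M i →ₗ[ℝ] M j)}

open Classical in
/-- The canonical map from `M i` to the colimit. -/
def VectColim.of (M : ι → Type v) [∀ i, AddCommGroup (M i)] [∀ i, Module ℝ (M i)]
    (A : ∀ i j, Set (M i →ₗ[ℝ] M j)) (i : ι) : M i →ₗ[ℝ] VectColim M A :=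
  (colimRel M A).mkQ ∘ₗ DirectSum.lof ℝ ι M i

theorem VectColim.of_apply {i j : ι} {φ : M i →ₗ[ℝ] M j} (hφ : φ ∈ A i j) (v : M i) :
    VectColim.of M A j (φ v) = VectColim.of M A i v := by
  refine ((Submodule.Quotient.eq (colimRel M A)).2 ?_).symm
  exact Submodule.subset_span ⟨i, j, φ, hφ, v, rfl⟩

open Classical in
/-- The linear map out of the colimit given by a cocone. -/
def VectColim.desc {N : Type w} [AddCommGroup N] [Module ℝ N] (h : ∀ i, M i →ₗ[ℝ] N)
    (hh : ∀ i j, ∀ φ ∈ A i j, h j ∘ₗ φ = h i) : VectColim M A →ₗ[ℝ] N :=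
  (colimRel M A).liftQ (DirectSum.toModule ℝ ι N h) <| by
    rw [colimRel, Submodule.span_le]
    rintro _ ⟨i, j, φ, hφ, v, rfl⟩
    have := LinearMap.congr_fun (hh i j φ hφ) v
    simpa [sub_eq_zero] using this.symm

@[simp] theorem VectColim.desc_of {N : Type w} [AddCommGroup N] [Module ℝ N]
    (h : ∀ i, M i →ₗ[ℝ] N) (hh : ∀ i j, ∀ φ ∈ A i j, h j ∘ₗ φ = h i) (i : ι) (v : M i) :
    VectColim.desc h hh (VectColim.of M A i v) = h i v := by
  simp [VectColim.desc, VectColim.of]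

end Colim

/-! ### The internal tangent bundle -/

/-- The usual tangent bundle `TU = U × ℝⁿ → U` of an open subset `U` of `ℝⁿ`. -/
abbrev opensTangent {n : ℕ} (U : Opens (Euc n)) : VPB.{0, 0} U where
  fib _ := Euc n
  diffeology := inducedDiffeology (fun z : Σ _ : U, Euc n ↦ (z.1 : Euc n)) ⊓
    inducedDiffeology (fun z : Σ _ : U, Euc n ↦ z.2)
  isVPB := by
    have key {m : ℕ} (c : Euc m → Σ _ : U, Euc n) := DiffeologicalSpace.isPlot_inf_iff
      (d₁ := inducedDiffeology (fun z : Σ _ : U, Euc n ↦ (z.1 : Euc n)))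
      (d₂ := inducedDiffeology (fun z : Σ _ : U, Euc n ↦ z.2)) (p := c)
    constructor
    · exact fun m c hc ↦ ((key c).1 hc).1
    · intro m q s t hs ht
      refine (key _).2 ⟨((key _).1 hs).1, ?_⟩
      have h : ContDiff ℝ ∞ s := isPlot_iff_contDiff.1 ((key _).1 hs).2
      have h' : ContDiff ℝ ∞ t := isPlot_iff_contDiff.1 ((key _).1 ht).2
      exact (isPlot_iff_contDiff (p := fun a ↦ s a + t a)).2 (h.add h')
    · intro m q r s hr hs
      refine (key _).2 ⟨((key _).1 hs).1, ?_⟩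
      have h : ContDiff ℝ ∞ s := isPlot_iff_contDiff.1 ((key _).1 hs).2
      have h' : ContDiff ℝ ∞ r := isPlot_iff_contDiff.1 hr
      exact (isPlot_iff_contDiff (p := fun a ↦ r a • s a)).2 (h'.smul h)
    · exact fun m c hc ↦ (key _).2 ⟨hc, isPlot_const (x := (0 : Euc n))⟩

section Tangent

variable {X : Type u} [DiffeologicalSpace X]

/-- The linear maps `f_* = D f(0) : T_0 U → T_0 V` induced by the morphisms of pointed plots. -/
def tangentArrows {x : X} (p q : PtPlot x) : Set (Euc p.dim →ₗ[ℝ] Euc q.dim) :=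
  {φ | ∃ f : p.toPlot.Hom q.toPlot, f.toFun 0 = 0 ∧ φ = (fderiv ℝ f.toFun 0).toLinearMap}

/-- The tangent space `T_x X`: the colimit of the `T_0 U` over the category of pointed plots
`(U, 0) → (X, x)`. -/
abbrev TangentSpaceAt (x : X) : Type u :=
  VectColim (fun p : PtPlot x ↦ Euc p.dim) tangentArrows

/-- The pointed plot obtained from a plot `p` with `p a = x` by translating `a` to `0`. -/
def PlotAt.translate {x : X} (P : PlotAt x) : PtPlot x where
  dim := P.dim
  dom := ⟨(fun b ↦ b + (P.pt : Euc P.dim)) ⁻¹' P.dom,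
    P.dom.isOpen.preimage (continuous_id.add continuous_const)⟩
  toFun b := P.toFun ⟨b.1 + P.pt, b.2⟩
  smooth n c hc := P.smooth n (fun a ↦ ⟨(c a).1 + P.pt, (c a).2⟩) <| by
    have h : ContDiff ℝ ∞ (fun a ↦ (c a).1) := isPlot_iff_contDiff.1 hc
    exact (isPlot_iff_contDiff (p := fun a ↦ (c a).1 + (P.pt : Euc P.dim))).2 (h.add contDiff_const)
  zero_mem := by
    change (0 : Euc P.dim) + P.pt ∈ P.dom
    rw [zero_add]; exact P.pt.2
  map_zero := by
    have : (⟨0 + (P.pt : Euc P.dim), by rw [zero_add]; exact P.pt.2⟩ : P.dom) = P.pt :=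
      Subtype.ext (zero_add _)
    exact (congrArg P.toFun this).trans P.map_pt

/-- The linear map `T_a p : T_a U → T_x X` induced by a plot `p : U → X` with `p a = x`. -/
def PlotAt.tangentMap {x : X} (P : PlotAt x) : Euc P.dim →ₗ[ℝ] TangentSpaceAt x :=
  VectColim.of (fun p : PtPlot x ↦ Euc p.dim) tangentArrows P.translate

/-- A plot at one of the points of its domain. -/
def Plot.at (p : Plot X) (a : p.dom) : PlotAt (p.toFun a) := ⟨p, a, rfl⟩

/-- The canonical map `Tp : TU → TX` of total spaces. -/
def Plot.tangentTotal (p : Plot X) (z : (opensTangent p.dom).Total) :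
    Σ x : X, TangentSpaceAt x :=
  ⟨p.toFun z.1, (p.at z.1).tangentMap z.2⟩

variable (X) in
/-- The internal tangent bundle `T^dvs X → X`: the dvsification of Hector's diffeology, which is
the diffeology on `TX = ∐ x, T_x X` generated by the maps `Tp : TU → TX` for the plots
`p : U → X`. -/
abbrev tangentBundle : VPB.{u, u} X where
  fib x := TangentSpaceAt x
  diffeology := dvsify _ (generatedDiffeology (fun p : Plot X ↦ p.tangentTotal))
  isVPB := isVPB_dvsify _ _ <| by
    intro n c hc
    refine hc (inducedDiffeology Sigma.fst) fun c' ⟨p, r, hr, h⟩ ↦ ?_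
    change IsPlot (Sigma.fst ∘ c'.2)
    rw [h]
    exact p.smooth _ _ ((opensTangent p.dom).isVPB.proj _ r hr)

/-! ### The bundle `T^k X` -/

/-- The linear maps `Λᵏ (D f(a)) : Λᵏ T_a U → Λᵏ T_{f(a)} V` induced by the morphisms of plots
with a chosen point over `x`. -/
def formArrows (k : ℕ) {x : X} (P Q : PlotAt x) :
    Set (⋀[ℝ]^k (Euc P.dim) →ₗ[ℝ] ⋀[ℝ]^k (Euc Q.dim)) :=
  {φ | ∃ f : P.toPlot.Hom Q.toPlot, f.toFun P.pt = Q.pt ∧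
    φ = exteriorPower.map k (fderiv ℝ f.toFun P.pt).toLinearMap}

/-- The fibre of `T^k X` over `x`: the colimit of the `Λᵏ T_a U` over the category of plots
`p : U → X` with a chosen point `a ∈ U` over `x`. -/
abbrev FormSpaceAt (k : ℕ) (x : X) : Type u :=
  VectColim (fun P : PlotAt x ↦ ⋀[ℝ]^k (Euc P.dim)) (formArrows k)

/-- The linear map `Λᵏ T_a U → (T^k X)_{p(a)}` of the colimit cocone. -/
def Plot.toFormSpace (k : ℕ) (p : Plot X) (a : p.dom) :
    ⋀[ℝ]^k (Euc p.dim) →ₗ[ℝ] FormSpaceAt k (p.toFun a) :=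
  VectColim.of (fun P : PlotAt (p.toFun a) ↦ ⋀[ℝ]^k (Euc P.dim)) (formArrows k) (p.at a)

/-- The map `Λᵏ TU → T^k X` of total spaces of the colimit cocone. -/
def Plot.formTotal (k : ℕ) (p : Plot X) (z : ((opensTangent p.dom).exterior k).Total) :
    Σ x : X, FormSpaceAt k x :=
  ⟨p.toFun z.1, p.toFormSpace k z.1 z.2⟩

variable (X) in
/-- The bundle `T^k X → X`, the colimit, in the category of diffeological vector pseudo-bundles,
of the bundles `Λᵏ TU → U` over the category of plots `U → X`: the fibres are colimits of vector
spaces, and the diffeology is the dvsification of the smallest one for which all the maps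
`Λᵏ TU → T^k X` are smooth. -/
abbrev formBundle (k : ℕ) : VPB.{u, u} X where
  fib x := FormSpaceAt k x
  diffeology := dvsify _ (generatedDiffeology (fun p : Plot X ↦ p.formTotal k))
  isVPB := isVPB_dvsify _ _ <| by
    intro n c hc
    refine hc (inducedDiffeology Sigma.fst) fun c' ⟨p, r, hr, h⟩ ↦ ?_
    change IsPlot (Sigma.fst ∘ c'.2)
    rw [h]
    exact p.smooth _ _ (((opensTangent p.dom).exterior k).isVPB.proj _ r hr)

/-- The maps `Λᵏ TU → T^k X` are smooth. -/
theorem dSmooth_toFormSpace (k : ℕ) (p : Plot X) :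
    DSmooth (fun z : ((opensTangent p.dom).exterior k).Total ↦
      (formBundle X k).elt (p.toFun z.1) (p.toFormSpace k z.1 z.2)) := by
  intro n c hc
  refine DiffeologicalSpace.le_iff'.1 (le_dvsify _ _) n _ ?_
  exact DiffeologicalSpace.isPlot_generatedFrom_of_mem ⟨p, c, hc, rfl⟩

/-- The maps `Λᵏ TU → T^k X` form a cocone over the category of plots. -/
theorem toFormSpace_compat (k : ℕ) (p q : Plot X) (f : p.Hom q) (a : p.dom) (w : ⋀[ℝ]^k (Euc p.dim)) :
    (formBundle X k).elt _ (q.toFormSpace k ⟨f.toFun a, f.mapsTo a.2⟩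
      (exteriorPower.map k (fderiv ℝ f.toFun a).toLinearMap w)) =
    (formBundle X k).elt _ (p.toFormSpace k a w) := by
  have h := f.comm a
  have h2 : ∀ x (hx : q.toFun ⟨f.toFun a, f.mapsTo a.2⟩ = x) (hx' : p.toFun a = x),
     (VectColim.of (fun P : PlotAt x ↦ ⋀[ℝ]^k (Euc P.dim)) (formArrows k) ⟨q, _, hx⟩
     (exteriorPower.map k (fderiv ℝ f.toFun a).toLinearMap w)) =
     (VectColim.of (fun P : PlotAt x ↦ ⋀[ℝ]^k (Euc P.dim)) (formArrows k) ⟨p, a, hx'⟩ w) := by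
    intro x hx hx'
    exact VectColim.of_apply (A := formArrows k) (i := (⟨p, a, hx'⟩ : PlotAt x)) (j := ⟨q, _, hx⟩)
      (by exact ⟨f, rfl, rfl⟩) w
  have h3 := h2 (p.toFun a) h rfl
  have key : ∀ x (hx : q.toFun ⟨f.toFun a, f.mapsTo a.2⟩ = x) (w' : ⋀[ℝ]^k (Euc q.dim)),
    (formBundle X k).elt _ (q.toFormSpace k ⟨f.toFun a, f.mapsTo a.2⟩ w') =
    (formBundle X k).elt x (VectColim.of (fun P : PlotAt x ↦ ⋀[ℝ]^k (Euc P.dim)) (formArrows k) ⟨q, _, hx⟩ w') := by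
    rintro _ rfl w'; rfl
  rw [key _ h, h3]; rfl

section UniversalProperty

variable {B' : Type w} [DiffeologicalSpace B'] (C : VPB.{w, z} B')

theorem VPB.elt_inj (b : B') (x y : C.fib b) (h : C.elt b x = C.elt b y) : x = y := by
  have h' : (⟨b, x⟩ : Σ b, C.fib b) = ⟨b, y⟩ := h
  exact eq_of_heq (Sigma.mk.inj h').2

/-- Equal points of the base have the same fibre. -/
def VPB.castFib {b b' : B'} (h : b = b') : C.fib b →ₗ[ℝ] C.fib b' := h ▸ LinearMap.id
theorem VPB.elt_castFib {b b' : B'} (h : b = b') (x : C.fib b) : C.elt b' (VPB.castFib C h x) = C.elt b x := by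
  subst h; rfl

/-- The universal property which makes `T^k X → X` the colimit of the bundles `Λᵏ TU → U` over the
category of plots `U → X` (note that `X` is the colimit of the `U`): every cocone of bundle maps to
a bundle `C → B'`, over the maps `g ∘ p : U → B'` with `g : X → B'` smooth, factors uniquely through
a bundle map `T^k X → C` over `g`. -/
theorem formBundle_existsUnique_desc (k : ℕ) (g : X → B') (hg : DSmooth g)
    (h : ∀ (p : Plot X) (a : p.dom), ⋀[ℝ]^k (Euc p.dim) →ₗ[ℝ] C.fib (g (p.toFun a)))
    (hs : ∀ p : Plot X, DSmooth (fun z : ((opensTangent p.dom).exterior k).Total ↦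
      C.elt (g (p.toFun z.1)) (h p z.1 z.2)))
    (hc : ∀ (p q : Plot X) (f : p.Hom q) (a : p.dom) w,
      C.elt _ (h q ⟨f.toFun a, f.mapsTo a.2⟩
        (exteriorPower.map k (fderiv ℝ f.toFun a).toLinearMap w)) = C.elt _ (h p a w)) :
    ∃! H : ∀ x, (formBundle X k).fib x →ₗ[ℝ] C.fib (g x),
      DSmooth (fun z : (formBundle X k).Total ↦ C.elt (g z.1) (H z.1 z.2)) ∧
      ∀ (p : Plot X) a w, H (p.toFun a) (p.toFormSpace k a w) = h p a w := by
  let H : ∀ x, (formBundle X k).fib x →ₗ[ℝ] C.fib (g x) := fun x ↦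
    VectColim.desc (fun P : PlotAt x ↦ VPB.castFib C (congrArg g P.map_pt) ∘ₗ h P.toPlot P.pt) (by
      rintro P Q φ ⟨f, hf, rfl⟩
      refine LinearMap.ext fun w ↦ ?_
      apply VPB.elt_inj
      have hpt : (⟨f.toFun P.pt, f.mapsTo P.pt.2⟩ : Q.dom) = Q.pt := Subtype.ext hf
      have := hc P.toPlot Q.toPlot f P.pt w
      rw [hpt] at this
      simp only [LinearMap.comp_apply, VPB.elt_castFib]
      exact this)
  have hH : ∀ (p : Plot X) a w, H (p.toFun a) (p.toFormSpace k a w) = h p a w := fun p a w ↦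
    (VectColim.desc_of (M := fun P : PlotAt (p.toFun a) ↦ ⋀[ℝ]^k (Euc P.dim)) (A := formArrows k) _ _ (p.at a) w).trans rfl
  refine ⟨H, ⟨?_, hH⟩, ?_⟩
  · let d : DiffeologicalSpace (Σ x, (formBundle X k).fib x) :=
      inducedDiffeology Sigma.fst ⊓ inducedDiffeology (fun z : Σ x, (formBundle X k).fib x ↦ C.elt (g z.1) (H z.1 z.2))
    have key {m : ℕ} (c : Euc m → Σ x, (formBundle X k).fib x) := DiffeologicalSpace.isPlot_inf_iff
      (d₁ := inducedDiffeology Sigma.fst)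
      (d₂ := inducedDiffeology (fun z : Σ x, (formBundle X k).fib x ↦ C.elt (g z.1) (H z.1 z.2))) (p := c)
    have hd : IsVPB (formBundle X k).fib d := by
      refine ⟨fun m c hc ↦ ((key c).1 hc).1, fun q s t hs ht ↦ (key _).2 ⟨((key _).1 hs).1, ?_⟩,
        fun q r s hr hs ↦ (key _).2 ⟨((key _).1 hs).1, ?_⟩, fun m c hc ↦ (key _).2 ⟨hc, ?_⟩⟩
      · have := C.isVPB.add (fun a ↦ g (q a)) (fun a ↦ H _ (s a)) (fun a ↦ H _ (t a)) ((key _).1 hs).2 ((key _).1 ht).2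
        refine Eq.mp ?_ this
        congr 1; funext a
        exact congrArg (C.elt _) (map_add _ _ _).symm
      · have := C.isVPB.smul (fun a ↦ g (q a)) r (fun a ↦ H _ (s a)) hr ((key _).1 hs).2
        refine Eq.mp ?_ this
        congr 1; funext a
        exact congrArg (C.elt _) (map_smul _ _ _).symm
      · have := C.isVPB.zero _ (g ∘ c) (hg _ _ hc)
        change IsPlot (fun a ↦ C.elt (g (c a)) (H _ 0))
        simp only [map_zero]; exact this
    have hle : generatedDiffeology (fun p : Plot X ↦ p.formTotal k) ≤ d := by
      rw [generatedDiffeology, DiffeologicalSpace.generateFrom_le_iff]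
      intro n c ⟨p, r, hr, hcr⟩
      have hcr' : c = p.formTotal k ∘ r := hcr
      rw [hcr']
      refine (key _).2 ⟨?_, ?_⟩
      · exact p.smooth _ _ (((opensTangent p.dom).exterior k).isVPB.proj _ r hr)
      · have := hs p _ r hr
        change IsPlot (fun a ↦ C.elt _ (H _ (p.toFormSpace k (r a).1 (r a).2)))
        simp only [hH]; exact this
    intro n c hc
    exact ((key _).1 (DiffeologicalSpace.le_iff'.1 (dvsify_le _ hle hd) n c hc)).2
  · classical
    rintro G ⟨-, hG⟩
    funext x
    refine Submodule.linearMap_qext _ (DirectSum.linearMap_ext _ fun P ↦ ?_)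
    obtain ⟨p, a, rfl⟩ := P
    refine LinearMap.ext fun w ↦ ?_
    exact (hG p a w).trans (hH p a w).symm

end UniversalProperty

/-! ### The comparison map `ρ` -/

theorem PlotAt.tangentMap_comp {x : X} {P Q : PlotAt x} (f : P.toPlot.Hom Q.toPlot)
    (hf : f.toFun P.pt = Q.pt) :
    Q.tangentMap ∘ₗ (fderiv ℝ f.toFun P.pt).toLinearMap = P.tangentMap := by
  ext v
  let g : P.translate.toPlot.Hom Q.translate.toPlot :=
    { toFun := fun b : Euc P.dim ↦ f.toFun (b + (P.pt : Euc P.dim)) - (Q.pt : Euc Q.dim)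
      contDiffOn := by
        have h : ContDiff ℝ ∞ (fun b : Euc P.dim ↦ b + (P.pt : Euc P.dim)) :=
          contDiff_id.add contDiff_const
        exact (f.contDiffOn.comp h.contDiffOn (fun b hb ↦ hb)).sub contDiffOn_const
      mapsTo := fun (b : Euc P.dim) hb ↦ by
        change f.toFun (b + P.pt) - (Q.pt : Euc Q.dim) + Q.pt ∈ Q.dom
        rw [sub_add_cancel]
        exact f.mapsTo hb
      comm := fun b ↦ by
        refine Eq.trans ?_ (f.comm ⟨(show Euc P.dim from b.1) + (P.pt : Euc P.dim), b.2⟩)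
        exact congrArg Q.toFun (Subtype.ext (sub_add_cancel _ _)) }
  have hg : (fderiv ℝ f.toFun P.pt).toLinearMap ∈ tangentArrows P.translate Q.translate := by
    refine ⟨g, ?_, ?_⟩
    · change f.toFun (0 + (P.pt : Euc P.dim)) - (Q.pt : Euc Q.dim) = 0
      rw [zero_add, hf, sub_self]
    · congr 1
      change _ = fderiv ℝ (fun b : Euc P.dim ↦ f.toFun (b + (P.pt : Euc P.dim)) - (Q.pt : Euc Q.dim)) 0
      rw [fderiv_sub_const, fderiv_comp_add_right, zero_add]
  exact VectColim.of_apply hg v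

/-- The comparison map `ρ : T^k X → Λᵏ T^dvs X` over `X`, induced by the maps
`Λᵏ Tp : Λᵏ TU → Λᵏ T^dvs X` for the plots `p : U → X`. -/
def rho (k : ℕ) (x : X) :
    (formBundle X k).fib x →ₗ[ℝ] ((tangentBundle X).exterior k).fib x :=
  VectColim.desc (fun P : PlotAt x ↦ exteriorPower.map k P.tangentMap) <| by
    rintro P Q φ ⟨f, hf, rfl⟩
    rw [← exteriorPower.map_comp, PlotAt.tangentMap_comp f hf]

theorem rho_toFormSpace (k : ℕ) (p : Plot X) (a : p.dom) (w : ⋀[ℝ]^k (Euc p.dim)) :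
    rho k (p.toFun a) (p.toFormSpace k a w) = exteriorPower.map k (p.at a).tangentMap w :=
  VectColim.desc_of (M := fun P : PlotAt (p.toFun a) ↦ ⋀[ℝ]^k (Euc P.dim)) (A := formArrows k)
    (fun P : PlotAt (p.toFun a) ↦ exteriorPower.map k P.tangentMap) _ (p.at a) w

end Tangent

/-! ### Differential forms -/

section Forms

variable (X : Type u) [DiffeologicalSpace X]

/-- The alternating `k`-forms on `ℝⁿ`. -/
abbrev Alt (k n : ℕ) := Euc n [⋀^Fin k]→L[ℝ] ℝ

/-- The differential `k`-forms on `X`: the families of smooth `k`-forms `α p ∈ Ω^k(U)`, one for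
each plot `p : U → X`, such that `f^* (α q) = α p` for each morphism `f : p → q` of plots. -/
def forms (k : ℕ) : Submodule ℝ (∀ p : Plot X, p.dom → Alt k p.dim) where
  carrier := {α | (∀ p, ContDiffOn ℝ ∞ (Function.extend Subtype.val (α p) 0) p.dom) ∧
    ∀ (p q : Plot X) (f : p.Hom q) (a : p.dom),
      α p a = (α q ⟨f.toFun a, f.mapsTo a.2⟩).compContinuousLinearMap (fderiv ℝ f.toFun a)}
  add_mem' {α β} hα hβ := by
    refine ⟨fun p ↦ ?_, fun p q f a ↦ ?_⟩
    · refine ((hα.1 p).add (hβ.1 p)).congr fun a ha ↦ ?_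
      lift a to p.dom using ha
      simp
    · rw [Pi.add_apply, Pi.add_apply, hα.2 p q f a, hβ.2 p q f a]
      rfl
  zero_mem' := by
    refine ⟨fun p ↦ ?_, fun p q f a ↦ rfl⟩
    refine (contDiffOn_const (c := (0 : Alt k p.dim))).congr fun a ha ↦ ?_
    lift a to p.dom using ha
    simp
  smul_mem' r α hα := by
    refine ⟨fun p ↦ ?_, fun p q f a ↦ ?_⟩
    · refine ((hα.1 p).const_smul r).congr fun a ha ↦ ?_
      lift a to p.dom using ha
      simp
    · rw [Pi.smul_apply, Pi.smul_apply, hα.2 p q f a]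
      rfl

/-- `Ω^k(X)` is the limit of the spaces `Ω^k(U) = C^∞(U, Λᵏ (ℝⁿ)*)` with the functional
diffeology: `σ : V → Ω^k(X)` is a plot iff, for each plot `p : U → X`, the map
`V × U → Λᵏ (ℝⁿ)*`, `(a, b) ↦ (σ a)_p(b)`, is smooth. -/
instance (k : ℕ) : DiffeologicalSpace (forms X k) where
  plots n := {σ : Euc n → forms X k | ∀ p : Plot X, ContDiffOn ℝ ∞
    (fun z : Euc n × Euc p.dim ↦ Function.extend Subtype.val ((σ z.1).1 p) 0 z.2)
    (Set.univ ×ˢ (p.dom : Set (Euc p.dim)))}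
  constant_plots α p := (α.2.1 p).comp contDiffOn_snd fun _ hz ↦ hz.2
  plot_reparam {n m σ f} hσ hf p := (hσ p).comp
    (f := fun z : Euc n × Euc p.dim ↦ (f z.1, z.2))
    ((hf.comp contDiff_fst).prodMk contDiff_snd).contDiffOn fun z hz ↦ ⟨trivial, hz.2⟩
  locality {n σ} hσ p := by
    rintro ⟨x, b⟩ ⟨-, hb⟩
    obtain ⟨W, hW, hx, h⟩ := hσ x
    obtain ⟨ε, hε, hεW⟩ := Metric.isOpen_iff.1 hW x hx
    let e := OpenPartialHomeomorph.univBall x ε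
    have he : ∀ y, e y ∈ W := fun y ↦ hεW <| by
      have := e.map_source (x := y) (by simp [e])
      rwa [OpenPartialHomeomorph.univBall_target x hε] at this
    have h₁ := h he OpenPartialHomeomorph.contDiff_univBall p
    have h₂ : ContDiffOn ℝ ∞ (fun z : Euc n × Euc p.dim ↦ (e.symm z.1, z.2))
        (Metric.ball x ε ×ˢ (p.dom : Set (Euc p.dim))) :=
      ((OpenPartialHomeomorph.contDiffOn_univBall_symm (c := x) (r := ε)).comp contDiffOn_fst
        fun z hz ↦ hz.1).prodMk contDiffOn_snd
    have h₃ := h₁.comp h₂ fun z hz ↦ ⟨trivial, hz.2⟩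
    have h₄ := h₃.congr (f₁ := fun z : Euc n × Euc p.dim ↦
      Function.extend Subtype.val ((σ z.1).1 p) 0 z.2) fun z hz ↦ by
        have : e (e.symm z.1) = z.1 :=
          e.right_inv (by rw [OpenPartialHomeomorph.univBall_target x hε]; exact hz.1)
        simp [this]
    exact (h₄.contDiffAt (((Metric.isOpen_ball).prod p.dom.isOpen).mem_nhds
      ⟨Metric.mem_ball_self hε, hb⟩)).contDiffWithinAt

end Forms

end DVPB

end

noncomputable section

namespace DVPB

universe u v w z

/-! On fibres, `ρ` compares the colimit of the spaces `Λᵏ T_0 U` with `Λᵏ` of the colimit of the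
`T_0 U`. In degree `0` every generator is identified with the one at the constant plot, and in
degree `1` the two colimits are the same. If `X` is filtered, exterior powers commute with the
colimit (`IsFilteredAt.bijective_rho`): finitely many tangent vectors come from one plot, which
gives surjectivity. For injectivity, the kernel of `T_0 U → T_x X` is finite-dimensional, so a
single arrow kills it, and over a field `Λᵏ` preserves injections. Only the germ category is
filtered, which suffices because derivatives at `0` depend only on germs and germs act on the
colimits.

The map `ρ` is always smooth, since smoothness of a fibrewise linear map can be tested on generators
of a dvsification (`dSmooth_dvsify_generated`). For the inverse it suffices to treat `y₁ ∧ ⋯ ∧ y_k`,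
with `y_j` plots of `T^dvs X` over a common plot of `X`. If locally `y_j = Tr ∘ (w, v_j)` with one
plot `r` and one base map `w`, the inverse image is the plot of `T^k X` given by `v₁ ∧ ⋯ ∧ v_k` over
`w` (`isPlot_of_locally_tangent`). In degree `0` there are no vectors to lift; in degree `1` one can
test on the generators `Tp` directly. For filtered `X`, maps that locally lift to a single plot
already form a pseudo-bundle diffeology, so they include all plots of `T^dvs X`
(`IsFilteredSpace.isLocallyTangent`), and several lifts over one plot of `X` can be moved to a
common plot (`IsFilteredSpace.exists_common_tangent`).

The second claim follows by dualizing. For the third, sections of `(T^k X)*` are the same as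
`k`-forms for every `X` (`sectionsEquivForms`): a compatible family of alternating forms is a
functional on the colimit, and smoothness in both directions is tested on wedges of vectors along
plots. The map `φ` is the composite of these two isomorphisms. -/

theorem IsPlot.congr {Y : Type*} [DiffeologicalSpace Y] {n : ℕ} {c c' : Euc n → Y} (hc : IsPlot c)
    (h : ∀ a, c a = c' a) : IsPlot c' :=
  funext h ▸ hc

/-! ### Smooth maps out of a dvsification -/

section Descent

variable {B : Type u} [DiffeologicalSpace B] {B' : Type w} [DiffeologicalSpace B']

/-- The smallest diffeology making the projection and a fibrewise linear map to a bundle smooth is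
that of a vector pseudo-bundle. -/
theorem isVPB_induced_inf (F : B → Type v) [∀ b, AddCommGroup (F b)] [∀ b, Module ℝ (F b)]
    (C : VPB.{w, z} B') {g : B → B'} (hg : DSmooth g) (H : ∀ b, F b →ₗ[ℝ] C.fib (g b)) :
    IsVPB F (inducedDiffeology Sigma.fst ⊓
      inducedDiffeology (fun z : Σ b, F b ↦ C.elt (g z.1) (H z.1 z.2))) := by
  let _ : DiffeologicalSpace (Σ b, F b) := inducedDiffeology Sigma.fst ⊓
      inducedDiffeology (fun z : Σ b, F b ↦ C.elt (g z.1) (H z.1 z.2))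
  have key {m : ℕ} (c : Euc m → Σ b, F b) := DiffeologicalSpace.isPlot_inf_iff
    (d₁ := inducedDiffeology Sigma.fst)
    (d₂ := inducedDiffeology (fun z : Σ b, F b ↦ C.elt (g z.1) (H z.1 z.2))) (p := c)
  refine ⟨fun m c hc ↦ ((key c).1 hc).1, fun q s t hs ht ↦ (key _).2 ⟨((key _).1 hs).1, ?_⟩,
    fun q r s hr hs ↦ (key _).2 ⟨((key _).1 hs).1, ?_⟩, fun m c hc ↦ (key _).2 ⟨hc, ?_⟩⟩
  · have := C.isVPB.add (fun a ↦ g (q a)) (fun a ↦ H _ (s a)) (fun a ↦ H _ (t a))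
      ((key _).1 hs).2 ((key _).1 ht).2
    refine Eq.mp ?_ this
    congr 1; funext a
    exact congrArg (C.elt _) (map_add _ _ _).symm
  · have := C.isVPB.smul (fun a ↦ g (q a)) r (fun a ↦ H _ (s a)) hr ((key _).1 hs).2
    refine Eq.mp ?_ this
    congr 1; funext a
    exact congrArg (C.elt _) (map_smul _ _ _).symm
  · have := C.isVPB.zero _ (g ∘ c) (hg _ _ hc)
    change IsPlot (fun a ↦ C.elt (g (c a)) (H _ 0))
    simp only [map_zero]; exact this

/-- A fibrewise linear map out of the dvsification of a generated diffeology is smooth as soon as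
its composites with the generating maps are. -/
theorem dSmooth_dvsify_generated {F : B → Type v} [∀ b, AddCommGroup (F b)]
    [∀ b, Module ℝ (F b)] {ι : Type*} {Y : ι → Type*} [∀ i, DiffeologicalSpace (Y i)]
    (f : ∀ i, Y i → Σ b, F b) (hf : ∀ i, DSmooth (fun y ↦ (f i y).1))
    (C : VPB.{w, z} B') {g : B → B'} (hg : DSmooth g) (H : ∀ b, F b →ₗ[ℝ] C.fib (g b))
    (h : ∀ i, DSmooth (fun y ↦ C.elt (g (f i y).1) (H _ (f i y).2))) :
    @DSmooth _ _ (dvsify F (generatedDiffeology f)) _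
      (fun z : Σ b, F b ↦ C.elt (g z.1) (H z.1 z.2)) := by
  -- The largest diffeology making the projection and the map smooth is a competitor in the infimum
  -- that defines the dvsification.
  have hle : generatedDiffeology f ≤ inducedDiffeology Sigma.fst ⊓
      inducedDiffeology (fun z : Σ b, F b ↦ C.elt (g z.1) (H z.1 z.2)) := by
    rw [generatedDiffeology, DiffeologicalSpace.generateFrom_le_iff]
    rintro n c ⟨i, r, hr, hcr⟩
    have hc : c = f i ∘ r := hcr
    rw [hc]
    exact DiffeologicalSpace.isPlot_inf_iff.2 ⟨hf i _ r hr, h i _ r hr⟩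
  intro n c hc
  exact (DiffeologicalSpace.isPlot_inf_iff.1 (DiffeologicalSpace.le_iff'.1
    (dvsify_le _ hle (isVPB_induced_inf F C hg H)) n c hc)).2

end Descent

/-! ### Exterior powers and bundle isomorphisms -/

namespace VPB

variable {B : Type u} [DiffeologicalSpace B] {B' : Type w} [DiffeologicalSpace B']

/-- A family of linear maps of the fibres of two bundles over a map of the bases. -/
abbrev FibreMap (E : VPB.{u, v} B) (g : B → B') (E' : VPB.{w, z} B') :=
  ∀ b, E.fib b →ₗ[ℝ] E'.fib (g b)

theorem isPlot_fibreProd_iff (E : VPB.{u, v} B) {k n : ℕ} {c : Euc n → E.FibreProd k} :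
    IsPlot c ↔ IsPlot (fun a ↦ (c a).1) ∧ ∀ i, IsPlot (fun a ↦ E.elt (c a).1 ((c a).2 i)) :=
  DiffeologicalSpace.isPlot_inf_iff.trans
    (and_congr Iff.rfl DiffeologicalSpace.isPlot_iInf_iff)

theorem dSmooth_wedge (E : VPB.{u, v} B) (k : ℕ) :
    DSmooth (fun y : E.FibreProd k ↦ (E.exterior k).elt y.1 (exteriorPower.ιMulti ℝ k y.2)) := by
  intro n c hc
  exact DiffeologicalSpace.le_iff'.1 (le_dvsify _ _) n _
    (DiffeologicalSpace.isPlot_generatedFrom_of_mem ⟨(), c, hc, rfl⟩)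

/-- A fibrewise linear map out of an exterior power is smooth as soon as it is so on wedge
products. -/
theorem dSmooth_exterior (E : VPB.{u, v} B) (k : ℕ) (C : VPB.{w, z} B') {g : B → B'}
    (hg : DSmooth g) (H : ∀ b, (E.exterior k).fib b →ₗ[ℝ] C.fib (g b))
    (h : DSmooth (fun y : E.FibreProd k ↦ C.elt (g y.1) (H _ (exteriorPower.ιMulti ℝ k y.2)))) :
    DSmooth (fun z : (E.exterior k).Total ↦ C.elt (g z.1) (H z.1 z.2)) :=
  dSmooth_dvsify_generated (fun _ : Unit ↦ E.wedge k)
    (fun _ _ _ hc ↦ (E.isPlot_fibreProd_iff.1 hc).1) C hg H fun _ ↦ h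

/-- The exterior power of a smooth fibrewise linear map is smooth. -/
theorem dSmooth_exterior_map (E : VPB.{u, v} B) (k : ℕ) (C : VPB.{w, z} B') {g : B → B'}
    (hg : DSmooth g) (H : ∀ b, E.fib b →ₗ[ℝ] C.fib (g b))
    (h : DSmooth (fun z : E.Total ↦ C.elt (g z.1) (H z.1 z.2))) :
    DSmooth (fun z : (E.exterior k).Total ↦
      (C.exterior k).elt (g z.1) (exteriorPower.map k (H z.1) z.2)) := by
  refine E.dSmooth_exterior k (C.exterior k) hg (fun b ↦ exteriorPower.map k (H b)) ?_
  intro n c hc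
  obtain ⟨h₁, h₂⟩ := E.isPlot_fibreProd_iff.1 hc
  refine IsPlot.congr (C.dSmooth_wedge k n (fun a ↦ ⟨g (c a).1, fun i ↦ H _ ((c a).2 i)⟩)
    (C.isPlot_fibreProd_iff.2 ⟨hg n _ h₁, fun i ↦ h n _ (h₂ i)⟩)) fun a ↦ ?_
  exact congrArg ((C.exterior k).elt _) (exteriorPower.map_apply_ιMulti _ _).symm

/-- The identification of a bundle with its first exterior power. -/
def exteriorOne (E : VPB.{u, v} B) : E.FibreMap id (E.exterior 1) :=
  fun b ↦ (exteriorPower.oneEquiv ℝ (E.fib b)).symm.toLinearMap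

theorem exteriorOne_apply (E : VPB.{u, v} B) (b : B) (e : E.fib b) :
    E.exteriorOne b e = exteriorPower.ιMulti ℝ 1 fun _ ↦ e :=
  exteriorPower.oneEquiv_symm_apply _ _ e

/-- A fibrewise linear map out of the first exterior power is smooth as soon as it is so on the
bundle itself. -/
theorem dSmooth_exterior_one (E : VPB.{u, v} B) (C : VPB.{w, z} B') {g : B → B'}
    (hg : DSmooth g) (H : (E.exterior 1).FibreMap g C)
    (h : DSmooth (fun z : E.Total ↦ C.elt (g z.1) (H z.1 (E.exteriorOne z.1 z.2)))) :
    DSmooth (fun z : (E.exterior 1).Total ↦ C.elt (g z.1) (H z.1 z.2)) := by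
  refine E.dSmooth_exterior 1 C hg H fun n c hc ↦ ?_
  refine IsPlot.congr (h n _ ((E.isPlot_fibreProd_iff.1 hc).2 0)) fun a ↦ ?_
  refine congrArg (fun t ↦ C.elt (g (c a).1) (H (c a).1 t)) ?_
  refine (E.exteriorOne_apply _ _).trans (congrArg _ (funext fun i ↦ ?_))
  rw [Subsingleton.elim i 0]
  rfl

/-- A smooth bijective bundle map with smooth inverse is an isomorphism of bundles. -/
theorem isBundleIso_of_bijective {E : VPB.{u, v} B} {E' : VPB.{u, w} B} (f : E.FibreMap id E')
    (hf : ∀ b, Function.Bijective (f b)) (hs : DSmooth (fun z : E.Total ↦ E'.elt z.1 (f z.1 z.2)))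
    (hinv : ∀ g : E'.FibreMap id E, (∀ b, Function.LeftInverse (g b) (f b)) →
      DSmooth (fun z : E'.Total ↦ E.elt z.1 (g z.1 z.2))) : IsBundleIso f := by
  let e := fun b ↦ LinearEquiv.ofBijective (f b) (hf b)
  refine ⟨hs, fun b ↦ (e b).symm.toLinearMap, hinv _ fun b ↦ (e b).symm_apply_apply,
    fun b ↦ ⟨?_, ?_⟩⟩
  · exact LinearMap.ext fun t ↦ (e b).symm_apply_apply t
  · exact LinearMap.ext fun t ↦ (e b).apply_symm_apply t

/-! ### Sections of dual bundles -/

section Dual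

variable {E : VPB.{u, v} B} {E' : VPB.{u, w} B}

theorem isPlot_dual_iff {n : ℕ} {c : Euc n → E.dual.Total} :
    IsPlot c ↔ IsPlot (fun a ↦ (c a).1) ∧
    ∀ (m : ℕ) (g : Euc m → Euc n) (e : ∀ a, E.fib (c (g a)).1), ContDiff ℝ ∞ g →
      IsPlot (fun a ↦ E.elt ((c (g a)).1) (e a)) →
      IsPlot (fun a ↦ (c (g a)).2.1 (e a)) := Iff.rfl

theorem isPlot_sections_iff {n : ℕ} {σ : Euc n → E.sections} :
    IsPlot σ ↔ ∀ (m : ℕ) (f : Euc m → Euc n) (g : Euc m → B),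
    ContDiff ℝ ∞ f → IsPlot g → IsPlot (fun a ↦ E.elt (g a) ((σ (f a)).1 (g a))) := Iff.rfl

/-- A plot of sections of the dual bundle evaluates smoothly. -/
theorem isPlot_eval_sections_dual {n m : ℕ} {σ : Euc n → E.dual.sections} (hσ : IsPlot σ)
    {f : Euc m → Euc n} (hf : ContDiff ℝ ∞ f) (e : Euc m → E.Total) (he : IsPlot e) :
    IsPlot (fun a ↦ ((σ (f a)).1 (e a).1).1 (e a).2) := by
  exact (isPlot_dual_iff.1 (isPlot_sections_iff.1 hσ m f _ hf (E.isVPB.proj _ e he))).2 m id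
    (fun a ↦ (e a).2) contDiff_id he

/-- Families of smooth linear functionals which evaluate smoothly are plots of sections of the
dual bundle. -/
theorem isPlot_sections_dual {n : ℕ} {σ : Euc n → E.dual.sections}
    (h : ∀ (m : ℕ) (f : Euc m → Euc n) (e : Euc m → E.Total), ContDiff ℝ ∞ f → IsPlot e →
      IsPlot (fun a ↦ ((σ (f a)).1 (e a).1).1 (e a).2)) : IsPlot σ := by
  refine isPlot_sections_iff.2 fun m f g hf hg ↦ isPlot_dual_iff.2 ⟨hg, fun l i e hi he ↦ ?_⟩
  exact h l (f ∘ i) (fun a ↦ E.elt (g (i a)) (e a)) (hf.comp hi) he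

/-- A family of linear functionals on the fibres which is smooth on the total space is a smooth
section of the dual bundle. -/
def dualSection (l : ∀ b, E.fib b →ₗ[ℝ] ℝ) (hl : DSmooth (fun z : E.Total ↦ l z.1 z.2)) :
    E.dual.sections :=
  ⟨fun b ↦ ⟨l b, fun n p hp ↦ hl n (fun a ↦ E.elt b (p a)) hp⟩, fun _ p hp ↦
    isPlot_dual_iff.2 ⟨hp, fun m i e _ he ↦ hl m (fun a ↦ E.elt (p (i a)) (e a)) he⟩⟩

theorem dSmooth_eval_section (s : E.dual.sections) :
    DSmooth (fun z : E.Total ↦ (s.1 z.1).1 z.2) := fun m e he ↦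
  isPlot_eval_sections_dual (n := m) (isPlot_const (x := s)) contDiff_id e he

/-- Precomposition of smooth sections of the dual bundle with a smooth bundle map. -/
def dualSectionsMap (f : ∀ b, E.fib b →ₗ[ℝ] E'.fib b) (hf : DSmooth (totalMap f)) :
    E'.dual.sections →ₗ[ℝ] E.dual.sections where
  toFun s := dualSection (fun b ↦ (s.1 b).1 ∘ₗ f b)
    fun n p hp ↦ dSmooth_eval_section s n _ (hf n p hp)
  map_add' _ _ := rfl
  map_smul' _ _ := rfl

theorem dSmooth_dualSectionsMap (f : ∀ b, E.fib b →ₗ[ℝ] E'.fib b) (hf : DSmooth (totalMap f)) :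
    DSmooth (dualSectionsMap f hf) := fun _ _ hσ ↦ isPlot_sections_dual fun m _ e hi he ↦
  isPlot_eval_sections_dual hσ hi (totalMap f ∘ e) (hf m e he)

/-- An isomorphism of bundles induces an isomorphism of the spaces of sections of the duals. -/
theorem IsBundleIso.exists_dualSectionsEquiv {f : ∀ b, E.fib b →ₗ[ℝ] E'.fib b}
    (hf : IsBundleIso f) : ∃ R : E'.dual.sections ≃ₗ[ℝ] E.dual.sections,
      DSmooth R ∧ DSmooth R.symm ∧
      ∀ s (b : B) (t : E.fib b), ((R s).1 b).1 t = (s.1 b).1 (f b t) := by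
  obtain ⟨hf, g, hg, hfg⟩ := hf
  refine ⟨LinearEquiv.ofLinearMap (dualSectionsMap f hf) (dualSectionsMap g hg) ?_ ?_,
    dSmooth_dualSectionsMap f hf, dSmooth_dualSectionsMap g hg, fun _ _ _ ↦ rfl⟩
  · ext s b t
    exact congrArg (s.1 b).1 (LinearMap.congr_fun (hfg b).1 t)
  · ext s b t
    exact congrArg (s.1 b).1 (LinearMap.congr_fun (hfg b).2 t)

end Dual

end VPB

/-! ### Smoothness tests and alternating forms on Euclidean spaces -/

section Analysis

variable {F : Type*} [NormedAddCommGroup F] [NormedSpace ℝ F]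

/-- A small ball around `x` is diffeomorphic to the whole space. This turns local data near `x` into
data on all of `ℝⁿ`, the only domain allowed for test maps. -/
theorem exists_univBall {n : ℕ} {W : Set (Euc n)} (hW : IsOpen W) {x : Euc n} (hx : x ∈ W) :
    ∃ e : OpenPartialHomeomorph (Euc n) (Euc n), ContDiff ℝ ∞ e ∧ (∀ y, e y ∈ W) ∧ e 0 = x ∧
      x ∈ e.target ∧ ContDiffOn ℝ ∞ e.symm e.target := by
  obtain ⟨ε, hε, hεW⟩ := Metric.isOpen_iff.1 hW x hx
  have ht := OpenPartialHomeomorph.univBall_target x hε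
  refine ⟨OpenPartialHomeomorph.univBall x ε, OpenPartialHomeomorph.contDiff_univBall, fun y ↦ ?_,
    OpenPartialHomeomorph.univBall_apply_zero x ε, ?_, ?_⟩
  · have := (OpenPartialHomeomorph.univBall x ε).map_source (x := y) (by simp)
    rw [ht] at this
    exact hεW this
  · rw [ht]; exact Metric.mem_ball_self hε
  · rw [ht]; exact OpenPartialHomeomorph.contDiffOn_univBall_symm

/-- Test on a diffeomorphism of `ℝⁿ` onto a ball inside `W`, then undo it by its smooth inverse. -/
theorem contDiffOn_of_comp_euc {n : ℕ} {W : Set (Euc n)} (hW : IsOpen W) {h : Euc n → F}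
    (hh : ∀ (m : ℕ) (f : Euc m → Euc n), ContDiff ℝ ∞ f → (∀ y, f y ∈ W) →
      ContDiff ℝ ∞ (h ∘ f)) : ContDiffOn ℝ ∞ h W := by
  intro x hx
  obtain ⟨e, he, heW, -, hxt, hes⟩ := exists_univBall hW hx
  have h₁ := (hh n e he heW).comp_contDiffOn hes
  refine ((h₁.congr fun y hy ↦ ?_).contDiffAt (e.open_target.mem_nhds hxt)).contDiffWithinAt
  simp [e.right_inv hy]

/-- Smoothness on an open subset of a finite-dimensional space can be tested on smooth maps from
Euclidean spaces. -/
theorem contDiffOn_of_comp {E : Type*} [NormedAddCommGroup E] [NormedSpace ℝ E]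
    [FiniteDimensional ℝ E] {W : Set E} (hW : IsOpen W) {h : E → F}
    (hh : ∀ (m : ℕ) (f : Euc m → E), ContDiff ℝ ∞ f → (∀ y, f y ∈ W) →
      ContDiff ℝ ∞ (h ∘ f)) : ContDiffOn ℝ ∞ h W := by
  let e : E ≃L[ℝ] Euc _ := toEuclidean
  have h₁ : ContDiffOn ℝ ∞ (h ∘ e.symm) (e.symm ⁻¹' W) :=
    contDiffOn_of_comp_euc (hW.preimage e.symm.continuous) fun m f hf hfW ↦
      hh m (e.symm ∘ f) (e.symm.contDiff.comp hf) hfW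
  refine (h₁.comp (g := h ∘ e.symm) e.contDiff.contDiffOn fun y hy ↦ ?_).congr fun y _ ↦ ?_
  · simpa using hy
  · simp

/-- Expansion in the standard basis. It reduces continuity and smoothness of alternating forms to
finitely many coefficients. -/
theorem multilinear_apply_eq_sum {k n : ℕ} (A : MultilinearMap ℝ (fun _ : Fin k ↦ Euc n) ℝ)
    (v : Fin k → Euc n) : A v = ∑ r : Fin k → Fin n,
      (∏ i, v i (r i)) * A (fun i ↦ EuclideanSpace.basisFun (Fin n) ℝ (r i)) := by
  have hv : v = fun i ↦ ∑ j, v i j • EuclideanSpace.basisFun (Fin n) ℝ j := by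
    funext i
    exact ((EuclideanSpace.basisFun (Fin n) ℝ).sum_repr (v i)).symm
  conv_lhs => rw [hv, MultilinearMap.map_sum]
  refine Finset.sum_congr rfl fun r _ ↦ ?_
  rw [MultilinearMap.map_smul_univ A (fun i ↦ v i (r i)), smul_eq_mul]

/-- Alternating maps on a Euclidean space are continuous. -/
def toAlt {k n : ℕ} (A : Euc n [⋀^Fin k]→ₗ[ℝ] ℝ) : Alt k n :=
  { A with
    cont := by
      change Continuous fun v ↦ A.toMultilinearMap v
      rw [funext (multilinear_apply_eq_sum A.toMultilinearMap)]
      fun_prop }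

variable {E : Type*} [NormedAddCommGroup E] [NormedSpace ℝ E]

/-- A map to the space of alternating forms is smooth if its evaluations are. -/
theorem contDiff_alt {k n : ℕ} {A : E → Alt k n}
    (h : ∀ v : Fin k → Euc n, ContDiff ℝ ∞ (fun a ↦ A a v)) : ContDiff ℝ ∞ A := by
  let L : Alt k n →ₗ[ℝ] ((Fin k → Fin n) → ℝ) :=
    { toFun B r := B fun i ↦ EuclideanSpace.basisFun (Fin n) ℝ (r i)
      map_add' _ _ := rfl
      map_smul' _ _ := rfl }
  have hL : L.ker = ⊥ := LinearMap.ker_eq_bot'.2 fun B hB ↦ by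
    ext v
    have := multilinear_apply_eq_sum B.toMultilinearMap v
    refine this.trans (Finset.sum_eq_zero fun r _ ↦ ?_)
    exact (congrArg _ (congrFun hB r)).trans (mul_zero _)
  -- A form is determined by its coefficients, and `G` recovers it from them linearly, hence
  -- smoothly in finite dimensions.
  obtain ⟨G, hG⟩ := L.exists_leftInverse_of_injective hL
  have hA : A = G.toContinuousLinearMap ∘ fun a r ↦ A a fun i ↦
      EuclideanSpace.basisFun (Fin n) ℝ (r i) := by
    funext a
    exact (LinearMap.congr_fun hG (A a)).symm
  rw [hA]
  exact G.toContinuousLinearMap.contDiff.comp (contDiff_pi.2 fun r ↦ h _)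

theorem ContDiff.alt_apply {k n : ℕ} {A : E → Alt k n} (hA : ContDiff ℝ ∞ A)
    {v : Fin k → E → Euc n} (hv : ∀ i, ContDiff ℝ ∞ (v i)) :
    ContDiff ℝ ∞ (fun a ↦ A a fun i ↦ v i a) := by
  have h : (fun a ↦ A a fun i ↦ v i a) = fun a ↦ ∑ r : Fin k → Fin n, (∏ i, v i a (r i)) *
      A a (fun i ↦ EuclideanSpace.basisFun (Fin n) ℝ (r i)) := by
    funext a
    exact multilinear_apply_eq_sum (A a).toMultilinearMap _
  rw [h]
  refine ContDiff.sum fun r _ ↦ (contDiff_prod fun i _ ↦ contDiff_euclidean.1 (hv i) (r i)).mul ?_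
  exact (ContinuousAlternatingMap.apply ℝ (Euc n) ℝ _).contDiff.comp hA

end Analysis

theorem isPlot_opens_iff {n m : ℕ} {U : Opens (Euc n)} {c : Euc m → U} :
    IsPlot c ↔ ContDiff ℝ ∞ (fun a ↦ (c a : Euc n)) :=
  isPlot_iff_contDiff (p := fun a ↦ (c a : Euc n))

theorem isPlot_opensTangent_iff {n m : ℕ} {U : Opens (Euc n)} {c : Euc m → (opensTangent U).Total} :
    IsPlot c ↔ ContDiff ℝ ∞ (fun a ↦ ((c a).1 : Euc n)) ∧
      ContDiff ℝ ∞ (fun a ↦ ((c a).2 : Euc n)) :=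
  DiffeologicalSpace.isPlot_inf_iff.trans (and_congr
    (isPlot_iff_contDiff (p := fun a ↦ ((c a).1 : Euc n)))
    (isPlot_iff_contDiff (p := fun a ↦ ((c a).2 : Euc n))))

/-! ### Filtered colimits of vector spaces and their exterior powers -/

section FilteredColim

variable {ι : Type u} {M : ι → Type v} [∀ i, AddCommGroup (M i)] [∀ i, Module ℝ (M i)]

/-- The linear maps `A i j` are closed under composition, any finite family of indices has an
upper bound, and parallel maps can be coequalized. -/
structure IsFilteredSystem (A : ∀ i j, Set (M i →ₗ[ℝ] M j)) : Prop where
  comp : ∀ {i j l}, ∀ φ ∈ A i j, ∀ ψ ∈ A j l, ψ ∘ₗ φ ∈ A i l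
  bound : ∀ (m : ℕ) (P : Fin m → ι), ∃ l, ∀ i, (A (P i) l).Nonempty
  coeq : ∀ {i j}, ∀ φ ∈ A i j, ∀ ψ ∈ A i j, ∃ l, ∃ χ ∈ A j l, χ ∘ₗ φ = χ ∘ₗ ψ

namespace IsFilteredSystem

variable {A : ∀ i j, Set (M i →ₗ[ℝ] M j)}

theorem bound_finset (hA : IsFilteredSystem A) (S : Finset ι) :
    ∃ l, ∀ i ∈ S, (A i l).Nonempty := by
  obtain ⟨l, hl⟩ := hA.bound S.card fun i ↦ (S.equivFin.symm i : ι)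
  refine ⟨l, fun i hi ↦ ?_⟩
  have h := hl (S.equivFin ⟨i, hi⟩)
  rwa [Equiv.symm_apply_apply] at h

/-- Over an upper bound of `j` and `l` the two composites out of `i` are parallel, so they can be
coequalized. -/
theorem span (hA : IsFilteredSystem A) {i j l : ι} {φ : M i →ₗ[ℝ] M j} (hφ : φ ∈ A i j)
    {ψ : M i →ₗ[ℝ] M l} (hψ : ψ ∈ A i l) :
    ∃ m, ∃ α ∈ A j m, ∃ β ∈ A l m, α ∘ₗ φ = β ∘ₗ ψ := by
  obtain ⟨b, hb⟩ := hA.bound 2 ![j, l]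
  obtain ⟨α, hα⟩ := hb 0
  obtain ⟨β, hβ⟩ := hb 1
  obtain ⟨m, χ, hχ, h⟩ := hA.coeq _ (hA.comp φ hφ α hα) _ (hA.comp ψ hψ β hβ)
  exact ⟨m, _, hA.comp α hα χ hχ, _, hA.comp β hβ χ hχ, h⟩

/-- The vectors which are killed by some map of the system. -/
def kernelAt (hA : IsFilteredSystem A) (i : ι) : Submodule ℝ (M i) where
  carrier := {v | ∃ j, ∃ φ ∈ A i j, φ v = 0}
  add_mem' := by
    rintro v v' ⟨j, φ, hφ, h⟩ ⟨l, ψ, hψ, h'⟩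
    obtain ⟨m, α, hα, β, hβ, hαβ⟩ := hA.span hφ hψ
    refine ⟨m, _, hA.comp φ hφ α hα, ?_⟩
    have := LinearMap.congr_fun hαβ v'
    simp only [LinearMap.comp_apply] at this
    simp [h, this, h']
  zero_mem' := by
    obtain ⟨l, hl⟩ := hA.bound 1 ![i]
    obtain ⟨φ, hφ⟩ := hl 0
    exact ⟨l, φ, hφ, map_zero φ⟩
  smul_mem' := by
    rintro r v ⟨j, φ, hφ, h⟩
    exact ⟨j, φ, hφ, by rw [map_smul, h, smul_zero]⟩

open Classical in
/-- The elements of the direct sum whose image in all sufficiently large members of the system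
is eventually zero. -/
def nullSpace (hA : IsFilteredSystem A) : Submodule ℝ (⨁ i, M i) where
  -- Enlarging `S` leaves fewer families `f` to test, so the witnesses of two elements can be merged
  -- by taking the union.
  carrier := {z | ∃ S : Finset ι, ∀ j (f : ∀ i, M i →ₗ[ℝ] M j), (∀ i ∈ S, f i ∈ A i j) →
    DirectSum.toModule ℝ ι (M j) f z ∈ hA.kernelAt j}
  add_mem' := by
    rintro z z' ⟨S, hS⟩ ⟨S', hS'⟩
    refine ⟨S ∪ S', fun j f hf ↦ ?_⟩
    rw [map_add]
    exact add_mem (hS j f fun i hi ↦ hf i (Finset.mem_union_left _ hi))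
      (hS' j f fun i hi ↦ hf i (Finset.mem_union_right _ hi))
  zero_mem' := ⟨∅, fun j f _ ↦ by rw [map_zero]; exact zero_mem _⟩
  smul_mem' := by
    rintro r z ⟨S, hS⟩
    refine ⟨S, fun j f hf ↦ ?_⟩
    rw [map_smul]
    exact Submodule.smul_mem _ _ (hS j f hf)

/-- For a relation given by `φ ∈ A i j`, the maps `f i` and `f j ∘ φ` are parallel; an arrow
coequalizing them kills the image of the relation. -/
theorem colimRel_le_nullSpace (hA : IsFilteredSystem A) : colimRel M A ≤ hA.nullSpace := by
  classical
  refine Submodule.span_le.2 ?_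
  rintro _ ⟨i, j, φ, hφ, v, rfl⟩
  refine ⟨{i, j}, fun l f hf ↦ ?_⟩
  obtain ⟨m, χ, hχ, h⟩ := hA.coeq _ (hf i (by simp)) _ (hA.comp φ hφ _ (hf j (by simp)))
  refine ⟨m, χ, hχ, ?_⟩
  have := LinearMap.congr_fun h v
  simp only [LinearMap.comp_apply] at this
  rw [map_sub, DirectSum.toModule_lof, DirectSum.toModule_lof, map_sub, this, sub_self]

/-- A vector which vanishes in a filtered colimit is killed by some map of the system. -/
theorem exists_apply_eq_zero (hA : IsFilteredSystem A) {i : ι} {v : M i}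
    (h : VectColim.of M A i v = 0) : ∃ j, ∃ φ ∈ A i j, φ v = 0 := by
  classical
  obtain ⟨S, hS⟩ := hA.colimRel_le_nullSpace ((Submodule.Quotient.mk_eq_zero _).1 h)
  -- The index `i` is included so that the test map, which sends the summand vector to `f i v`, uses
  -- an arrow of the system there.
  obtain ⟨l, hl⟩ := hA.bound_finset (insert i S)
  choose! f hf using hl
  have := hS l f fun j hj ↦ hf j (Finset.mem_insert_of_mem hj)
  rw [DirectSum.toModule_lof] at this
  obtain ⟨m, χ, hχ, h⟩ := this
  exact ⟨m, _, hA.comp _ (hf i (Finset.mem_insert_self _ _)) χ hχ, h⟩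

/-- The vectors are killed one at a time: the image of the next one under the arrow found so far
still vanishes in the colimit. -/
theorem exists_le_ker (hA : IsFilteredSystem A) (i : ι) (s : Finset (M i))
    (hs : ∀ v ∈ s, VectColim.of M A i v = 0) : ∃ j, ∃ φ ∈ A i j, ∀ v ∈ s, φ v = 0 := by
  classical
  induction s using Finset.induction_on with
  | empty =>
    obtain ⟨l, hl⟩ := hA.bound 1 ![i]
    obtain ⟨φ, hφ⟩ := hl 0
    exact ⟨l, φ, hφ, by simp⟩
  | insert v s _ ih =>
    obtain ⟨j, φ, hφ, h⟩ := ih fun v hv ↦ hs v (Finset.mem_insert_of_mem hv)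
    have hv : VectColim.of M A j (φ v) = 0 := by
      rw [VectColim.of_apply hφ, hs v (Finset.mem_insert_self _ _)]
    obtain ⟨l, ψ, hψ, h'⟩ := hA.exists_apply_eq_zero hv
    refine ⟨l, _, hA.comp φ hφ ψ hψ, fun v' hv' ↦ ?_⟩
    rcases Finset.mem_insert.1 hv' with rfl | hv'
    · exact h'
    · simp [h v' hv']

/-- If an element of an exterior power vanishes in the exterior power of the colimit, then it is
killed by some map of the system. -/
theorem exists_exteriorPower_map_eq_zero (hA : IsFilteredSystem A) {i : ι}
    [FiniteDimensional ℝ (M i)] {k : ℕ} {w : ⋀[ℝ]^k (M i)}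
    (h : exteriorPower.map k (VectColim.of M A i) w = 0) :
    ∃ j, ∃ φ ∈ A i j, exteriorPower.map k φ w = 0 := by
  -- The kernel is finitely generated, so one arrow `φ` kills all of it.
  obtain ⟨s, hs⟩ := IsNoetherian.noetherian (LinearMap.ker (VectColim.of M A i))
  obtain ⟨j, φ, hφ, hsφ⟩ := hA.exists_le_ker i s fun v hv ↦
    (hs ▸ Submodule.subset_span hv : v ∈ LinearMap.ker (VectColim.of M A i))
  refine ⟨j, φ, hφ, ?_⟩
  have hle : LinearMap.ker (VectColim.of M A i) ≤ LinearMap.ker φ := by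
    rw [← hs, Submodule.span_le]
    exact hsφ
  -- Both the map to the colimit and `φ` factor through the quotient by this kernel. The first
  -- factor `f₁` is injective, and so is `Λᵏ f₁` over a field; hence `w` already dies in `Λᵏ` of the
  -- quotient.
  let mk := (LinearMap.ker (VectColim.of M A i)).mkQ
  let f₁ := (LinearMap.ker (VectColim.of M A i)).liftQ (VectColim.of M A i) le_rfl
  let f₂ := (LinearMap.ker (VectColim.of M A i)).liftQ φ hle
  have h₁ : f₁ ∘ₗ mk = VectColim.of M A i := Submodule.liftQ_mkQ _ _ _
  have h₂ : f₂ ∘ₗ mk = φ := Submodule.liftQ_mkQ _ _ _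
  have hinj : Function.Injective f₁ := LinearMap.ker_eq_bot.1 (Submodule.ker_liftQ_eq_bot' _ _ rfl)
  have h₃ : exteriorPower.map k mk w = 0 := by
    refine exteriorPower.map_injective_field (n := k) hinj ?_
    rw [map_zero, ← LinearMap.comp_apply, ← exteriorPower.map_comp, h₁, h]
  rw [← h₂, exteriorPower.map_comp, LinearMap.comp_apply, h₃, map_zero]

end IsFilteredSystem

/-- If any finite family of indices has an upper bound, then every finite family of vectors of the
colimit comes from a single member of the system. -/
theorem VectColim.exists_of_eq {A : ∀ i j, Set (M i →ₗ[ℝ] M j)}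
    (h : ∀ (m : ℕ) (P : Fin m → ι), ∃ l, ∀ i, ∃ φ : M (P i) →ₗ[ℝ] M l,
      VectColim.of M A l ∘ₗ φ = VectColim.of M A (P i)) {m : ℕ} (t : Fin m → VectColim M A) :
    ∃ i, ∃ v : Fin m → M i, ∀ j, VectColim.of M A i (v j) = t j := by
  classical
  have key : ∀ t : VectColim M A, ∃ i, ∃ v : M i, VectColim.of M A i v = t := by
    intro t
    obtain ⟨z, rfl⟩ := Submodule.mkQ_surjective _ t
    induction z using DirectSum.induction_on with
    | zero =>
      -- The bound of the empty family supplies an index.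
      obtain ⟨i, -⟩ := h 0 Fin.elim0
      exact ⟨i, 0, by rw [map_zero, map_zero]⟩
    | of i v => exact ⟨i, v, rfl⟩
    | add z z' hz hz' =>
      obtain ⟨i, v, hv⟩ := hz
      obtain ⟨j, v', hv'⟩ := hz'
      obtain ⟨l, hl⟩ := h 2 ![i, j]
      obtain ⟨φ, hφ⟩ := hl 0
      obtain ⟨ψ, hψ⟩ := hl 1
      refine ⟨l, φ v + ψ v', ?_⟩
      rw [map_add, map_add, ← hv, ← hv']
      exact congrArg₂ _ (LinearMap.congr_fun hφ v) (LinearMap.congr_fun hψ v')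
  choose P v hv using fun j ↦ key (t j)
  obtain ⟨l, hl⟩ := h m P
  choose φ hφ using hl
  exact ⟨l, fun j ↦ φ j (v j), fun j ↦ (LinearMap.congr_fun (hφ j) (v j)).trans (hv j)⟩

end FilteredColim

/-! ### Germs of pointed plots acting on the colimits -/

section Germs

variable {X : Type u} [DiffeologicalSpace X]

/-- The restriction of a plot to a smaller open set. -/
abbrev Plot.restrict (p : Plot X) (W : Opens (Euc p.dim)) : Plot X where
  dim := p.dim
  dom := p.dom ⊓ W
  toFun b := p.toFun ⟨b.1, b.2.1⟩
  smooth n c hc := p.smooth n (fun a ↦ ⟨(c a).1, (c a).2.1⟩) hc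

def Plot.restrictHom (p : Plot X) (W : Opens (Euc p.dim)) : (p.restrict W).Hom p where
  toFun := id
  contDiffOn := contDiffOn_id
  mapsTo _ hb := hb.1
  comm _ := rfl

abbrev PtPlot.restrict {x : X} (p : PtPlot x) (W : Opens (Euc p.dim)) (h : 0 ∈ W) : PtPlot x where
  toPlot := p.toPlot.restrict W
  zero_mem := ⟨p.zero_mem, h⟩
  map_zero := p.map_zero

abbrev PtPlot.toPlotAt {x : X} (p : PtPlot x) : PlotAt x := ⟨p.toPlot, ⟨0, p.zero_mem⟩, p.map_zero⟩

section

variable {x : X} {p q r : PtPlot x} {f : Euc p.dim → Euc q.dim} {h : Euc q.dim → Euc r.dim}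

theorem Plot.Hom.isGermHom (f : p.toPlot.Hom q.toPlot) (hf : f.toFun 0 = 0) :
    IsGermHom p q f.toFun := by
  have hp := p.dom.isOpen.mem_nhds p.zero_mem
  refine ⟨?_, hf, ?_⟩
  · filter_upwards [p.dom.isOpen.mem_nhds p.zero_mem] with a ha
    exact f.contDiffOn.contDiffAt (p.dom.isOpen.mem_nhds ha)
  · filter_upwards [hp] with a ha
    exact ⟨ha, f.mapsTo ha, f.comm ⟨a, ha⟩⟩

theorem IsGermHom.exists_hom (hf : IsGermHom p q f) : ∃ (W : Opens (Euc p.dim)) (h0 : 0 ∈ W)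
    (g : (p.restrict W h0).toPlot.Hom q.toPlot), g.toFun = f := by
  obtain ⟨W, hW, hWo, h0⟩ := eventually_nhds_iff.1 (hf.1.and hf.2.2)
  exact ⟨⟨W, hWo⟩, h0, ⟨f, fun a ha ↦ (hW a ha.2).1.contDiffWithinAt,
    fun a ha ↦ (hW a ha.2).2.choose_spec.choose,
    fun a ↦ (hW a.1 a.2.2).2.choose_spec.choose_spec⟩, rfl⟩

theorem IsGermHom.contDiffAt (hf : IsGermHom p q f) : ContDiffAt ℝ ∞ f 0 := hf.1.self_of_nhds

theorem IsGermHom.differentiableAt (hf : IsGermHom p q f) : DifferentiableAt ℝ f 0 :=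
  hf.contDiffAt.differentiableAt (by simp)

theorem IsGermHom.tendsto (hf : IsGermHom p q f) : Filter.Tendsto f (𝓝 0) (𝓝 0) := by
  simpa [ContinuousAt, hf.2.1] using hf.contDiffAt.continuousAt

theorem IsGermHom.comp (hh : IsGermHom q r h) (hf : IsGermHom p q f) : IsGermHom p r (h ∘ f) := by
  refine ⟨?_, by simp [hf.2.1, hh.2.1], ?_⟩
  · filter_upwards [hf.1, hf.tendsto.eventually hh.1] with a h₁ h₂
    exact h₂.comp a h₁
  · filter_upwards [hf.2.2, hf.tendsto.eventually hh.2.2] with a ⟨h₁, h₂, h₃⟩ ⟨h₄, h₅, h₆⟩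
    exact ⟨h₁, h₅, h₆.trans h₃⟩

theorem IsGermHom.fderiv_comp (hh : IsGermHom q r h) (hf : IsGermHom p q f) :
    (fderiv ℝ (h ∘ f) 0).toLinearMap =
      (fderiv ℝ h 0).toLinearMap ∘ₗ (fderiv ℝ f 0).toLinearMap := by
  have h₁ : DifferentiableAt ℝ h (f 0) := by rw [hf.2.1]; exact hh.differentiableAt
  rw [_root_.fderiv_comp 0 h₁ hf.differentiableAt, hf.2.1]
  rfl

end

theorem isGermHom_id {x : X} (p : PtPlot x) : IsGermHom p p id :=
  ⟨.of_forall fun _ ↦ contDiffAt_id, rfl, by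
    filter_upwards [p.dom.isOpen.mem_nhds p.zero_mem] with a ha using ⟨ha, ha, rfl⟩⟩

/-- The derivatives of the germs of smooth maps between pointed plots. -/
def germArrows {x : X} (p q : PtPlot x) : Set (Euc p.dim →ₗ[ℝ] Euc q.dim) :=
  {φ | ∃ f, IsGermHom p q f ∧ φ = (fderiv ℝ f 0).toLinearMap}

/-- Derivatives at `0` are functorial by the chain rule and depend only on germs, so a germ
coequalizing two germs has a derivative coequalizing their derivatives. -/
theorem IsFilteredAt.isFilteredSystem {x : X} (hx : IsFilteredAt x) :
    IsFilteredSystem (ι := PtPlot x) (M := fun p ↦ Euc p.dim) germArrows where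
  comp := by
    rintro p q r _ ⟨f, hf, rfl⟩ _ ⟨g, hg, rfl⟩
    exact ⟨g ∘ f, hg.comp hf, (hg.fderiv_comp hf).symm⟩
  bound m P := by
    obtain ⟨r, hr⟩ := hx.1 m P
    exact ⟨r, fun i ↦ (hr i).elim fun f hf ↦ ⟨_, f, hf, rfl⟩⟩
  coeq := by
    rintro p q _ ⟨f, hf, rfl⟩ _ ⟨g, hg, rfl⟩
    obtain ⟨r, h, hh, hfg⟩ := hx.2 p q f g hf hg
    refine ⟨r, _, ⟨h, hh, rfl⟩, ?_⟩
    rw [← hh.fderiv_comp hf, ← hh.fderiv_comp hg, hfg.fderiv_eq]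

/-- The canonical map `T_0 U → T_x X` of a pointed plot. -/
def PtPlot.tangentMap {x : X} (p : PtPlot x) : Euc p.dim →ₗ[ℝ] TangentSpaceAt x :=
  VectColim.of (fun p : PtPlot x ↦ Euc p.dim) tangentArrows p

/-- The canonical map `Λᵏ T_0 U → (T^k X)_x` of a pointed plot. -/
def PtPlot.toFormSpace {x : X} (k : ℕ) (p : PtPlot x) :
    ⋀[ℝ]^k (Euc p.dim) →ₗ[ℝ] FormSpaceAt k x :=
  VectColim.of (fun P : PlotAt x ↦ ⋀[ℝ]^k (Euc P.dim)) (formArrows k) p.toPlotAt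

section

variable {x : X} {p q : PtPlot x} {f : Euc p.dim → Euc q.dim}

theorem PtPlot.tangentMap_hom (f : p.toPlot.Hom q.toPlot) (hf : f.toFun 0 = 0) :
    q.tangentMap ∘ₗ (fderiv ℝ f.toFun 0).toLinearMap = p.tangentMap :=
  LinearMap.ext fun v ↦ VectColim.of_apply (A := tangentArrows) (i := p) (j := q) ⟨f, hf, rfl⟩ v

theorem PtPlot.toFormSpace_hom (k : ℕ) (f : p.toPlot.Hom q.toPlot) (hf : f.toFun 0 = 0) :
    q.toFormSpace k ∘ₗ exteriorPower.map k (fderiv ℝ f.toFun 0).toLinearMap = p.toFormSpace k :=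
  LinearMap.ext fun v ↦ VectColim.of_apply (A := formArrows k) (i := p.toPlotAt) (j := q.toPlotAt)
    ⟨f, hf, rfl⟩ v

/-- After shrinking the domain of `p` the germ is a morphism of plots, and the inclusion of the
smaller domain has the identity as derivative. -/
theorem IsGermHom.tangentMap_comp (hf : IsGermHom p q f) :
    q.tangentMap ∘ₗ (fderiv ℝ f 0).toLinearMap = p.tangentMap := by
  obtain ⟨W, h0, g, rfl⟩ := hf.exists_hom
  rw [PtPlot.tangentMap_hom g hf.2.1]
  have := PtPlot.tangentMap_hom (p := p.restrict W h0) (q := p) (p.restrictHom W) rfl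
  rw [← this]
  change _ ∘ₗ (fderiv ℝ id 0).toLinearMap = _
  rw [fderiv_id]
  rfl

theorem IsGermHom.toFormSpace_comp (k : ℕ) (hf : IsGermHom p q f) :
    q.toFormSpace k ∘ₗ exteriorPower.map k (fderiv ℝ f 0).toLinearMap = p.toFormSpace k := by
  obtain ⟨W, h0, g, rfl⟩ := hf.exists_hom
  rw [PtPlot.toFormSpace_hom k g hf.2.1]
  have := PtPlot.toFormSpace_hom (p := p.restrict W h0) (q := p) k (p.restrictHom W) rfl
  rw [← this]
  change _ ∘ₗ exteriorPower.map k (fderiv ℝ id 0).toLinearMap = _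
  rw [fderiv_id]
  exact (congrArg _ exteriorPower.map_id).trans (LinearMap.comp_id _)

end

/-- The translation which maps `0` to the chosen point of a plot. -/
def PlotAt.translateHom {x : X} (P : PlotAt x) : P.translate.toPlot.Hom P.toPlot where
  toFun := fun b : Euc P.dim ↦ b + (P.pt : Euc P.dim)
  contDiffOn := (contDiff_id.add contDiff_const).contDiffOn
  mapsTo _ hb := hb
  comm _ := rfl

theorem PlotAt.fderiv_translateHom {x : X} (P : PlotAt x) :
    fderiv ℝ P.translateHom.toFun 0 = ContinuousLinearMap.id ℝ (Euc P.dim) := by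
  change fderiv ℝ (fun b : Euc P.dim ↦ b + (P.pt : Euc P.dim)) 0 = _
  rw [fderiv_add_const]
  exact fderiv_id

/-- A translation has identity derivative. This reconciles the index categories of the two colimits:
arbitrary base points for `T^k X`, the origin for `T_x X`. -/
theorem PlotAt.toFormSpace_translate {x : X} (k : ℕ) (P : PlotAt x) :
    P.translate.toFormSpace k =
      VectColim.of (fun P : PlotAt x ↦ ⋀[ℝ]^k (Euc P.dim)) (formArrows k) P := by
  refine LinearMap.ext fun w ↦ ?_
  have := VectColim.of_apply (M := fun P : PlotAt x ↦ ⋀[ℝ]^k (Euc P.dim)) (A := formArrows k)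
    (i := P.translate.toPlotAt) (j := P) ⟨P.translateHom, zero_add _, rfl⟩ w
  have hw : exteriorPower.map k (fderiv ℝ P.translateHom.toFun 0).toLinearMap w = w := by
    rw [P.fderiv_translateHom]
    exact LinearMap.congr_fun exteriorPower.map_id w
  exact this.symm.trans (congrArg (VectColim.of (fun P : PlotAt x ↦ ⋀[ℝ]^k (Euc P.dim))
    (formArrows k) P) hw)

theorem PtPlot.tangentMap_toPlotAt {x : X} (p : PtPlot x) :
    p.toPlotAt.tangentMap = p.tangentMap := by
  have := PtPlot.tangentMap_hom (q := p) p.toPlotAt.translateHom (zero_add _)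
  rw [p.toPlotAt.fderiv_translateHom] at this
  exact this.symm

theorem rho_ptPlot_toFormSpace {x : X} (k : ℕ) (p : PtPlot x) (w : ⋀[ℝ]^k (Euc p.dim)) :
    rho k x (p.toFormSpace k w) = exteriorPower.map k p.tangentMap w := by
  rw [← p.tangentMap_toPlotAt]
  exact VectColim.desc_of (M := fun P : PlotAt x ↦ ⋀[ℝ]^k (Euc P.dim)) (A := formArrows k)
    (fun P : PlotAt x ↦ exteriorPower.map k P.tangentMap) _ p.toPlotAt w

/-- Two linear maps on `(T^k X)_x` agree if they agree on the images of pointed plots. -/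
theorem FormSpaceAt.hom_ext {x : X} {k : ℕ} {N : Type*} [AddCommGroup N] [Module ℝ N]
    {F G : FormSpaceAt k x →ₗ[ℝ] N}
    (h : ∀ p : PtPlot x, F ∘ₗ p.toFormSpace k = G ∘ₗ p.toFormSpace k) : F = G := by
  classical
  refine Submodule.linearMap_qext _ (DirectSum.linearMap_ext _ fun P ↦ ?_)
  have := h P.translate
  rw [P.toFormSpace_translate] at this
  exact this

theorem TangentSpaceAt.hom_ext {x : X} {N : Type*} [AddCommGroup N] [Module ℝ N]
    {F G : TangentSpaceAt x →ₗ[ℝ] N}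
    (h : ∀ p : PtPlot x, F ∘ₗ p.tangentMap = G ∘ₗ p.tangentMap) : F = G := by
  classical
  exact Submodule.linearMap_qext _ (DirectSum.linearMap_ext _ fun p ↦ h p)

/-! ### Bijectivity of the comparison map on the fibres -/

/-- The constant plot at `x`, defined on `ℝ⁰`. -/
def constPlot (x : X) : PtPlot x where
  dim := 0
  dom := ⊤
  toFun _ := x
  smooth _ _ _ := isPlot_const
  zero_mem := trivial
  map_zero := rfl

theorem isGermHom_constPlot {x : X} (p : PtPlot x) : IsGermHom (constPlot x) p (fun _ ↦ 0) :=
  ⟨.of_forall fun _ ↦ contDiffAt_const, rfl, .of_forall fun _ ↦ ⟨trivial, p.zero_mem, p.map_zero⟩⟩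

/-- The constant plot maps to every pointed plot, so all generators `Λ⁰ T_0 U = ℝ` are identified
with the single class `e`. -/
theorem bijective_rho_zero (x : X) : Function.Bijective (rho 0 x) := by
  let e : FormSpaceAt 0 x := (constPlot x).toFormSpace 0 (exteriorPower.ιMulti ℝ 0 Fin.elim0)
  let g : ⋀[ℝ]^0 (TangentSpaceAt x) →ₗ[ℝ] FormSpaceAt 0 x :=
    (LinearMap.toSpanSingleton ℝ _ e) ∘ₗ (exteriorPower.zeroEquiv ℝ (TangentSpaceAt x)).toLinearMap
  have hg : ∀ v, g (exteriorPower.ιMulti ℝ 0 v) = e := fun v ↦ by simp [g]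
  refine Function.bijective_iff_has_inverse.2 ⟨g, ?_, ?_⟩
  · refine LinearMap.congr_fun (f := g ∘ₗ rho 0 x) (g := LinearMap.id)
      (FormSpaceAt.hom_ext fun p ↦ exteriorPower.linearMap_ext (AlternatingMap.ext fun v ↦ ?_))
    change g (rho 0 x (p.toFormSpace 0 (exteriorPower.ιMulti ℝ 0 v))) =
      p.toFormSpace 0 (exteriorPower.ιMulti ℝ 0 v)
    rw [rho_ptPlot_toFormSpace, exteriorPower.map_apply_ιMulti, hg]
    change (constPlot x).toFormSpace 0 _ = _
    rw [← (isGermHom_constPlot p).toFormSpace_comp 0, LinearMap.comp_apply,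
      exteriorPower.map_apply_ιMulti]
    congr 2
  · refine LinearMap.congr_fun (f := rho 0 x ∘ₗ g) (g := LinearMap.id)
      (exteriorPower.linearMap_ext (AlternatingMap.ext fun v ↦ ?_))
    change rho 0 x (g (exteriorPower.ιMulti ℝ 0 v)) = exteriorPower.ιMulti ℝ 0 v
    rw [hg, rho_ptPlot_toFormSpace, exteriorPower.map_apply_ιMulti]
    exact congrArg _ (Subsingleton.elim _ _)

/-- Since `Λ¹ V = V` naturally, the inverse is induced by the cocone of maps `T_0 U = Λ¹ T_0 U → (T¹
X)_x`. -/
theorem bijective_rho_one (x : X) : Function.Bijective (rho 1 x) := by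
  let g₀ : TangentSpaceAt x →ₗ[ℝ] FormSpaceAt 1 x :=
    VectColim.desc (M := fun p : PtPlot x ↦ Euc p.dim) (A := tangentArrows)
      (fun p ↦ p.toFormSpace 1 ∘ₗ (exteriorPower.oneEquiv ℝ (Euc p.dim)).symm.toLinearMap) <| by
        rintro p q _ ⟨f, hf, rfl⟩
        refine LinearMap.ext fun v ↦ ?_
        rw [← PtPlot.toFormSpace_hom 1 f hf]
        simp only [LinearMap.comp_apply, LinearEquiv.coe_coe, exteriorPower.oneEquiv_symm_apply,
          exteriorPower.map_apply_ιMulti]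
        rfl
  have hg₀ : ∀ (p : PtPlot x) (v : Euc p.dim), g₀ (p.tangentMap v) =
      p.toFormSpace 1 (exteriorPower.ιMulti ℝ 1 fun _ ↦ v) := fun p v ↦ by
    refine (VectColim.desc_of (M := fun p : PtPlot x ↦ Euc p.dim) (A := tangentArrows)
      _ _ p v).trans ?_
    simp [exteriorPower.oneEquiv_symm_apply]
  let g : ⋀[ℝ]^1 (TangentSpaceAt x) →ₗ[ℝ] FormSpaceAt 1 x :=
    g₀ ∘ₗ (exteriorPower.oneEquiv ℝ (TangentSpaceAt x)).toLinearMap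
  have hg : ∀ (p : PtPlot x) (v : Fin 1 → Euc p.dim),
      g (exteriorPower.ιMulti ℝ 1 (p.tangentMap ∘ v)) =
      p.toFormSpace 1 (exteriorPower.ιMulti ℝ 1 v) := fun p v ↦ by
    simp only [g, LinearMap.comp_apply, LinearEquiv.coe_coe, exteriorPower.oneEquiv_ιMulti,
      Function.comp_apply, hg₀]
    congr 2
  refine Function.bijective_iff_has_inverse.2 ⟨g, ?_, ?_⟩
  · refine LinearMap.congr_fun (f := g ∘ₗ rho 1 x) (g := LinearMap.id)
      (FormSpaceAt.hom_ext fun p ↦ exteriorPower.linearMap_ext (AlternatingMap.ext fun v ↦ ?_))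
    change g (rho 1 x (p.toFormSpace 1 (exteriorPower.ιMulti ℝ 1 v))) =
      p.toFormSpace 1 (exteriorPower.ιMulti ℝ 1 v)
    rw [rho_ptPlot_toFormSpace, exteriorPower.map_apply_ιMulti, hg]
  · have key : (exteriorPower.oneEquiv ℝ (TangentSpaceAt x)).toLinearMap ∘ₗ rho 1 x ∘ₗ g₀ =
        LinearMap.id := by
      refine TangentSpaceAt.hom_ext fun p ↦ LinearMap.ext fun v ↦ ?_
      change exteriorPower.oneEquiv ℝ (TangentSpaceAt x) (rho 1 x (g₀ (p.tangentMap v))) =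
        p.tangentMap v
      rw [hg₀, rho_ptPlot_toFormSpace, exteriorPower.map_apply_ιMulti,
        exteriorPower.oneEquiv_ιMulti]
      rfl
    intro t
    apply (exteriorPower.oneEquiv ℝ (TangentSpaceAt x)).injective
    exact LinearMap.congr_fun key (exteriorPower.oneEquiv ℝ (TangentSpaceAt x) t)

theorem IsWeaklyFilteredAt.exists_tangentMap_eq {x : X} (hx : IsWeaklyFilteredAt x) {m : ℕ}
    (t : Fin m → TangentSpaceAt x) :
    ∃ (p : PtPlot x) (v : Fin m → Euc p.dim), ∀ j, p.tangentMap (v j) = t j :=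
  VectColim.exists_of_eq (fun m P ↦ (hx m P).imp fun _ hr i ↦
    (hr i).elim fun _ hf ↦ ⟨_, hf.tangentMap_comp⟩) t

theorem IsWeaklyFilteredAt.exists_toFormSpace_eq {x : X} (hx : IsWeaklyFilteredAt x) {k : ℕ}
    (t : FormSpaceAt k x) : ∃ (p : PtPlot x) (w : ⋀[ℝ]^k (Euc p.dim)), p.toFormSpace k w = t := by
  obtain ⟨P, w, hw⟩ := VectColim.exists_of_eq (A := formArrows (x := x) k) (fun m P ↦ by
    obtain ⟨r, hr⟩ := hx m fun i ↦ (P i).translate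
    refine ⟨r.toPlotAt, fun i ↦ ?_⟩
    obtain ⟨f, hf⟩ := hr i
    refine ⟨exteriorPower.map k (fderiv ℝ f 0).toLinearMap, ?_⟩
    have := hf.toFormSpace_comp k
    rw [(P i).toFormSpace_translate] at this
    exact this) fun _ : Fin 1 ↦ t
  refine ⟨P.translate, w 0, ?_⟩
  rw [P.toFormSpace_translate]
  exact hw 0

theorem IsFilteredAt.bijective_rho {x : X} (hx : IsFilteredAt x) (k : ℕ) :
    Function.Bijective (rho k x) := by
  constructor
  · refine (injective_iff_map_eq_zero _).2 fun t ht ↦ ?_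
    obtain ⟨p, w, rfl⟩ := hx.1.exists_toFormSpace_eq t
    rw [rho_ptPlot_toFormSpace] at ht
    have hc : ∀ p q : PtPlot x, ∀ φ ∈ tangentArrows p q,
        VectColim.of (fun p : PtPlot x ↦ Euc p.dim) germArrows q ∘ₗ φ =
          VectColim.of (fun p : PtPlot x ↦ Euc p.dim) germArrows p := by
      rintro p q _ ⟨f, hf, rfl⟩
      exact LinearMap.ext fun v ↦ VectColim.of_apply (A := germArrows)
        ⟨f.toFun, f.isGermHom hf, rfl⟩ v
    -- Filteredness is known for germs only, so the vanishing is pushed forward to the colimit over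
    -- germs.
    let D : TangentSpaceAt x →ₗ[ℝ] VectColim (fun p : PtPlot x ↦ Euc p.dim) germArrows :=
      VectColim.desc _ hc
    have hD : D ∘ₗ p.tangentMap = VectColim.of (fun p : PtPlot x ↦ Euc p.dim) germArrows p :=
      LinearMap.ext fun v ↦ VectColim.desc_of (A := tangentArrows) _ hc p v
    have h0 : exteriorPower.map k
        (VectColim.of (fun p : PtPlot x ↦ Euc p.dim) germArrows p) w = 0 := by
      rw [← hD, exteriorPower.map_comp, LinearMap.comp_apply, ht, map_zero]
    obtain ⟨q, _, ⟨f, hf, rfl⟩, hw⟩ := hx.isFilteredSystem.exists_exteriorPower_map_eq_zero h0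
    rw [← hf.toFormSpace_comp k, LinearMap.comp_apply, hw, map_zero]
  -- Decomposable vectors span, and their `k` factors come from one pointed plot; weak filteredness
  -- suffices here.
  · rw [← LinearMap.range_eq_top, ← top_le_iff, ← exteriorPower.ιMulti_span, Submodule.span_le]
    rintro _ ⟨t, rfl⟩
    obtain ⟨p, v, hv⟩ := hx.1.exists_tangentMap_eq t
    refine ⟨p.toFormSpace k (exteriorPower.ιMulti ℝ k v), ?_⟩
    rw [rho_ptPlot_toFormSpace, exteriorPower.map_apply_ιMulti]
    exact congrArg _ (funext hv)

end Germs

/-! ### Differential forms as sections of the dual of `T^k X` -/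

/-- The vector space `C^∞(ℝⁿ, ℝ)`. -/
def smoothFunctions (n : ℕ) : Submodule ℝ (Euc n → ℝ) where
  carrier := {f | ContDiff ℝ ∞ f}
  add_mem' {f g} (hf : ContDiff ℝ ∞ f) (hg : ContDiff ℝ ∞ g) := hf.add hg
  zero_mem' := (contDiff_const : ContDiff ℝ ∞ fun _ : Euc n ↦ (0 : ℝ))
  smul_mem' r f (hf : ContDiff ℝ ∞ f) := hf.const_smul r

/-- The trivial bundle with fibre `C^∞(ℝⁿ, ℝ)`. -/
def functionBundle (B : Type u) [DiffeologicalSpace B] (n : ℕ) : VPB.{u, 0} B where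
  fib _ := smoothFunctions n
  diffeology :=
    { plots := fun m ↦ {c : Euc m → Σ _ : B, smoothFunctions n | IsPlot (fun a ↦ (c a).1) ∧
        ∀ (l : ℕ) (r : Euc l → Euc m) (b : Euc l → Euc n), ContDiff ℝ ∞ r → ContDiff ℝ ∞ b →
          ContDiff ℝ ∞ (fun y ↦ (c (r y)).2.1 (b y))}
      constant_plots := fun c ↦ ⟨isPlot_const, fun l r b _ hb ↦ ContDiff.comp c.2.2 hb⟩
      plot_reparam := fun {n m p f} hp hf ↦
        ⟨isPlot_reparam hp.1 hf, fun l r b hr hb ↦ hp.2 l (f ∘ r) b (hf.comp hr) hb⟩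
      locality := fun {m c} hc ↦ by
        refine ⟨DiffeologicalSpace.locality fun x ↦ ?_, fun l r b hr hb ↦
          isPlot_iff_contDiff.1 (DiffeologicalSpace.locality fun x ↦ ?_)⟩
        · obtain ⟨W, hW, hx, h⟩ := hc x
          exact ⟨W, hW, hx, fun hfW hf ↦ (h hfW hf).1⟩
        · obtain ⟨W, hW, hx, h⟩ := hc (r x)
          refine ⟨r ⁻¹' W, hW.preimage hr.continuous, hx, fun {l' f} hfW hf ↦ ?_⟩
          exact isPlot_iff_contDiff.2 ((h (f := r ∘ f) hfW (hr.comp hf)).2 l' id (b ∘ f)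
            contDiff_id (hb.comp hf)) }
  isVPB := by
    refine @IsVPB.mk _ _ _ _ _ _ (fun n p hp ↦ hp.1) (fun q s t hs ht ↦ ⟨hs.1, ?_⟩)
      (fun q r s hr hs ↦ ⟨hs.1, ?_⟩) (fun n p hp ↦ ⟨hp, fun _ _ _ _ _ ↦ contDiff_const⟩)
    · exact fun l i b hi hb ↦ (hs.2 l i b hi hb).add (ht.2 l i b hi hb)
    · exact fun l i b hi hb ↦ ((isPlot_iff_contDiff.1 hr).comp hi).mul (hs.2 l i b hi hb)

theorem isPlot_functionBundle_iff {B : Type u} [DiffeologicalSpace B] {n m : ℕ}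
    {c : Euc m → (functionBundle B n).Total} : IsPlot c ↔ IsPlot (fun a ↦ (c a).1) ∧
      ∀ (l : ℕ) (r : Euc l → Euc m) (b : Euc l → Euc n), ContDiff ℝ ∞ r → ContDiff ℝ ∞ b →
        ContDiff ℝ ∞ (fun y ↦ (c (r y)).2.1 (b y)) := Iff.rfl

section Forms

variable {X : Type u} [DiffeologicalSpace X] {k : ℕ}

theorem isPlot_forms_iff {n : ℕ} {σ : Euc n → forms X k} : IsPlot σ ↔ ∀ p : Plot X,
    ContDiffOn ℝ ∞ (fun z : Euc n × Euc p.dim ↦ Function.extend Subtype.val ((σ z.1).1 p) 0 z.2)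
      (Set.univ ×ˢ (p.dom : Set (Euc p.dim))) := Iff.rfl

theorem contDiff_plot_forms {n : ℕ} {σ : Euc n → forms X k} (hσ : IsPlot σ) (p : Plot X) {m : ℕ}
    {b : Euc m → Euc n} (hb : ContDiff ℝ ∞ b) {c : Euc m → p.dom}
    (hc : ContDiff ℝ ∞ (fun y ↦ (c y : Euc p.dim))) :
    ContDiff ℝ ∞ (fun y ↦ (σ (b y)).1 p (c y)) := by
  have h := (isPlot_forms_iff.1 hσ p).comp_contDiff (hb.prodMk hc) fun y ↦ ⟨trivial, (c y).2⟩
  refine Eq.mp ?_ h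
  congr 1
  funext y
  exact Subtype.val_injective.extend_apply _ _ _

/-- The linear functional on `(T^k X)_x` given by a differential form. -/
def formPairing (α : forms X k) (x : X) : FormSpaceAt k x →ₗ[ℝ] ℝ :=
  VectColim.desc (M := fun P : PlotAt x ↦ ⋀[ℝ]^k (Euc P.dim)) (A := formArrows k)
    (fun P ↦ exteriorPower.alternatingMapLinearEquiv (α.1 P.toPlot P.pt).toAlternatingMap) <| by
      rintro P Q _ ⟨f, hf, rfl⟩
      have hpt : (⟨f.toFun P.pt, f.mapsTo P.pt.2⟩ : Q.dom) = Q.pt := Subtype.ext hf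
      refine exteriorPower.linearMap_ext (AlternatingMap.ext fun v ↦ ?_)
      have := congrArg (fun A ↦ A v) (α.2.2 P.toPlot Q.toPlot f P.pt)
      rw [hpt] at this
      simp only [LinearMap.compAlternatingMap_apply, LinearMap.comp_apply,
        exteriorPower.map_apply_ιMulti, exteriorPower.alternatingMapLinearEquiv_apply_ιMulti]
      exact this.symm

theorem formPairing_of (α : forms X k) {x : X} (P : PlotAt x) (v : Fin k → Euc P.dim) :
    formPairing α x (VectColim.of (fun P : PlotAt x ↦ ⋀[ℝ]^k (Euc P.dim)) (formArrows k) P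
      (exteriorPower.ιMulti ℝ k v)) = α.1 P.toPlot P.pt v := by
  refine (VectColim.desc_of (M := fun P : PlotAt x ↦ ⋀[ℝ]^k (Euc P.dim)) (A := formArrows k)
    _ _ P _).trans ?_
  exact exteriorPower.alternatingMapLinearEquiv_apply_ιMulti _ _

theorem formPairing_toFormSpace (α : forms X k) (p : Plot X) (a : p.dom)
    (v : Fin k → Euc p.dim) : formPairing α (p.toFun a)
      (p.toFormSpace k a (exteriorPower.ιMulti ℝ k v)) = α.1 p a v :=
  formPairing_of α (p.at a) v

theorem contDiff_formPairing {n : ℕ} {σ : Euc n → forms X k} (hσ : IsPlot σ) {x : X}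
    (t : FormSpaceAt k x) : ContDiff ℝ ∞ (fun b ↦ formPairing (σ b) x t) := by
  let S : Submodule ℝ (FormSpaceAt k x) :=
    { carrier := {t | ContDiff ℝ ∞ (fun b ↦ formPairing (σ b) x t)}
      add_mem' := fun {t t'} ht ht' ↦ by
        simp only [Set.mem_ofPred_eq, map_add]
        exact ContDiff.add ht ht'
      zero_mem' := by
        simp only [Set.mem_ofPred_eq, map_zero]
        exact contDiff_const
      smul_mem' := fun r t ht ↦ by
        simp only [Set.mem_ofPred_eq, map_smul]
        exact ContDiff.const_smul r ht }
  -- That `S` is everything is phrased as the vanishing of its quotient map, which can be checked on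
  -- the generators of the colimit.
  have hS : S.mkQ = 0 := by
    refine FormSpaceAt.hom_ext fun p ↦ exteriorPower.linearMap_ext (AlternatingMap.ext fun v ↦ ?_)
    refine (Submodule.Quotient.mk_eq_zero S).2 ?_
    change ContDiff ℝ ∞ (fun b ↦ formPairing (σ b) x 
      (VectColim.of (fun P : PlotAt x ↦ ⋀[ℝ]^k (Euc P.dim)) (formArrows k) p.toPlotAt
        (exteriorPower.ιMulti ℝ k v)))
    rw [funext fun b ↦ formPairing_of (σ b) p.toPlotAt v]
    exact (ContinuousAlternatingMap.apply ℝ (Euc p.dim) ℝ v).contDiff.comp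
      (contDiff_plot_forms hσ p.toPlot contDiff_id (c := fun _ ↦ p.toPlotAt.pt) contDiff_const)
  exact (Submodule.Quotient.mk_eq_zero S).1 (LinearMap.congr_fun hS t)

/-- The family of linear functionals given by a family of forms. -/
def formPairingFamily {n : ℕ} {σ : Euc n → forms X k} (hσ : IsPlot σ) (x : X) :
    FormSpaceAt k x →ₗ[ℝ] smoothFunctions n where
  toFun t := ⟨fun b ↦ formPairing (σ b) x t, contDiff_formPairing hσ t⟩
  map_add' _ _ := Subtype.ext (funext fun _ ↦ map_add _ _ _)
  map_smul' _ _ := Subtype.ext (funext fun _ ↦ map_smul _ _ _)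

/-- Descent handles fibrewise linear maps on `T^k X`, with no room for the parameter of `σ`. Moving
the parameter into the fibre `C^∞(ℝⁿ, ℝ)` makes the whole family one such map, which is then tested
on wedges of vectors along plots. -/
theorem dSmooth_formPairingFamily {n : ℕ} {σ : Euc n → forms X k} (hσ : IsPlot σ) :
    DSmooth (fun e : (formBundle X k).Total ↦
      (functionBundle X n).elt e.1 (formPairingFamily hσ e.1 e.2)) := by
  refine dSmooth_dvsify_generated (fun p : Plot X ↦ p.formTotal k) (fun p m c hc ↦ ?_)
    (functionBundle X n) (g := id) (fun _ _ hp ↦ hp) (formPairingFamily hσ) fun p ↦ ?_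
  · exact p.smooth _ _ (((opensTangent p.dom).exterior k).isVPB.proj _ c hc)
  · refine (opensTangent p.dom).dSmooth_exterior k (functionBundle X n) p.smooth
      (fun a ↦ formPairingFamily hσ (p.toFun a) ∘ₗ p.toFormSpace k a) fun m c hc ↦ ?_
    obtain ⟨h₁, h₂⟩ := (opensTangent p.dom).isPlot_fibreProd_iff.1 hc
    refine isPlot_functionBundle_iff.2 ⟨p.smooth _ _ h₁, fun l r b hr hb ↦ ?_⟩
    change ContDiff ℝ ∞ (fun y ↦ formPairing (σ (b y)) (p.toFun (c (r y)).1)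
      (p.toFormSpace k (c (r y)).1 (exteriorPower.ιMulti ℝ k (c (r y)).2)))
    simp only [formPairing_toFormSpace]
    exact ContDiff.alt_apply (contDiff_plot_forms hσ p hb ((isPlot_opens_iff.1 h₁).comp hr))
      fun i ↦ (isPlot_opensTangent_iff.1 (h₂ i)).2.comp hr

theorem isPlot_formPairing {n m : ℕ} {σ : Euc n → forms X k} (hσ : IsPlot σ)
    {f : Euc m → Euc n} (hf : ContDiff ℝ ∞ f) {e : Euc m → (formBundle X k).Total}
    (he : IsPlot e) : IsPlot (fun a ↦ formPairing (σ (f a)) (e a).1 (e a).2) :=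
  isPlot_iff_contDiff.2
    ((isPlot_functionBundle_iff.1 (dSmooth_formPairingFamily hσ m e he)).2 m id f contDiff_id hf)

/-- The section of the dual of `T^k X` given by a differential form. -/
def formsToSections : forms X k →ₗ[ℝ] (formBundle X k).dual.sections where
  toFun α := VPB.dualSection (formPairing α) fun m e he ↦
    isPlot_formPairing (n := m) (isPlot_const (x := α)) contDiff_id he
  map_add' α β := Subtype.ext <| funext fun x ↦ Subtype.ext <| FormSpaceAt.hom_ext fun p ↦
    exteriorPower.linearMap_ext <| AlternatingMap.ext fun v ↦ by
      exact (formPairing_of (α + β) p.toPlotAt v).trans <| .symm <|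
        congrArg₂ (· + ·) (formPairing_of α p.toPlotAt v) (formPairing_of β p.toPlotAt v)
  map_smul' r α := Subtype.ext <| funext fun x ↦ Subtype.ext <| FormSpaceAt.hom_ext fun p ↦
    exteriorPower.linearMap_ext <| AlternatingMap.ext fun v ↦ by
      exact (formPairing_of (r • α) p.toPlotAt v).trans <| .symm <|
        congrArg (r • ·) (formPairing_of α p.toPlotAt v)

theorem dSmooth_formsToSections : DSmooth (formsToSections (X := X) (k := k)) := fun _ _ hσ ↦
  VPB.isPlot_sections_dual fun _ _ _ hf he ↦ isPlot_formPairing hσ hf he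

/-- The alternating forms on the domain of a plot given by a section of the dual of `T^k X`. -/
def sectionForm (s : (formBundle X k).dual.sections) (p : Plot X) (a : p.dom) : Alt k p.dim :=
  toAlt (((s.1 (p.toFun a)).1 ∘ₗ p.toFormSpace k a).compAlternatingMap (exteriorPower.ιMulti ℝ k))

theorem sectionForm_apply (s : (formBundle X k).dual.sections) (p : Plot X) (a : p.dom)
    (v : Fin k → Euc p.dim) : sectionForm s p a v =
      (s.1 (p.toFun a)).1 (p.toFormSpace k a (exteriorPower.ιMulti ℝ k v)) := rfl

theorem sectionForm_comp (s : (formBundle X k).dual.sections) {p q : Plot X} (f : p.Hom q)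
    (a : p.dom) (v : Fin k → Euc p.dim) : sectionForm s p a v =
      sectionForm s q ⟨f.toFun a, f.mapsTo a.2⟩ (fderiv ℝ f.toFun a ∘ v) := by
  -- The vectors to be compared lie over points that are only propositionally equal; evaluation on
  -- the total space avoids a transport.
  let ev : (formBundle X k).Total → ℝ := fun e ↦ (s.1 e.1).1 e.2
  have h := congrArg ev (toFormSpace_compat k p q f a (exteriorPower.ιMulti ℝ k v))
  rw [exteriorPower.map_apply_ιMulti] at h
  rw [sectionForm_apply, sectionForm_apply]
  exact h.symm

/-- It suffices to evaluate on constant vectors along test maps into the domain; their wedge is a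
plot of `Λᵏ TU`, so its image is a plot of `T^k X`, on which `σ` evaluates smoothly. -/
theorem contDiffOn_sectionForm {n : ℕ} {σ : Euc n → (formBundle X k).dual.sections}
    (hσ : IsPlot σ) (p : Plot X) : ContDiffOn ℝ ∞
      (fun z : Euc n × Euc p.dim ↦ Function.extend Subtype.val (sectionForm (σ z.1) p) 0 z.2)
      (Set.univ ×ˢ (p.dom : Set (Euc p.dim))) := by
  refine contDiffOn_of_comp (isOpen_univ.prod p.dom.isOpen) fun m f hf hfW ↦ ?_
  let c : Euc m → p.dom := fun y ↦ ⟨(f y).2, (hfW y).2⟩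
  have hc : IsPlot c := isPlot_opens_iff.2 hf.snd
  have h : (fun z : Euc n × Euc p.dim ↦
      Function.extend Subtype.val (sectionForm (σ z.1) p) 0 z.2) ∘ f =
      fun y ↦ sectionForm (σ (f y).1) p (c y) := by
    funext y
    exact Subtype.val_injective.extend_apply (sectionForm (σ (f y).1) p) 0 (c y)
  rw [h]
  refine contDiff_alt fun v ↦ ?_
  have hw := (opensTangent p.dom).dSmooth_wedge k m (fun y ↦ ⟨c y, v⟩)
    ((opensTangent p.dom).isPlot_fibreProd_iff.2 ⟨hc, fun i ↦
      isPlot_opensTangent_iff.2 ⟨isPlot_opens_iff.1 hc, contDiff_const⟩⟩)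
  exact isPlot_iff_contDiff.1 <| VPB.isPlot_eval_sections_dual hσ (f := fun y ↦ (f y).1) hf.fst _
    (dSmooth_toFormSpace k p m _ hw)

/-- The differential form given by a section of the dual of `T^k X`. -/
def sectionsToForms : (formBundle X k).dual.sections →ₗ[ℝ] forms X k where
  -- A single section is a family parametrized by `ℝ⁰`.
  toFun s := ⟨sectionForm s, fun p ↦ (contDiffOn_sectionForm (n := 0)
      (isPlot_const (x := s)) p).comp (f := fun a ↦ ((0 : Euc 0), a))
      (contDiff_const.prodMk contDiff_id).contDiffOn fun _ ha ↦ ⟨trivial, ha⟩,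
    fun _ _ f a ↦ ContinuousAlternatingMap.ext (sectionForm_comp s f a)⟩
  map_add' _ _ := rfl
  map_smul' _ _ := rfl

theorem dSmooth_sectionsToForms : DSmooth (sectionsToForms (X := X) (k := k)) := fun _ _ hσ ↦
  isPlot_forms_iff.2 fun p ↦ contDiffOn_sectionForm hσ p

/-- Sections of the dual of `T^k X` are the same as differential forms. -/
def sectionsEquivForms : (formBundle X k).dual.sections ≃ₗ[ℝ] forms X k :=
  LinearEquiv.ofLinearMap sectionsToForms formsToSections
    (LinearMap.ext fun α ↦ Subtype.ext <| funext fun p ↦ funext fun a ↦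
      ContinuousAlternatingMap.ext fun v ↦ formPairing_toFormSpace α p a v)
    (LinearMap.ext fun s ↦ Subtype.ext <| funext fun x ↦ Subtype.ext <|
      FormSpaceAt.hom_ext fun p ↦ exteriorPower.linearMap_ext <| AlternatingMap.ext fun v ↦ by
        obtain ⟨p, h0, rfl⟩ := p
        exact formPairing_of (sectionsToForms s) (p.at ⟨0, h0⟩) v)

end Forms

section LocalForm

variable {X : Type u} [DiffeologicalSpace X]

/-! ### Germs at arbitrary points -/

section

variable {x : X}

theorem PlotAt.isGermHom_translate (P Q : PlotAt x) {f : Euc P.dim → Euc Q.dim}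
    (hpt : f P.pt = Q.pt)
    (hf : ∀ᶠ b in 𝓝 (P.pt : Euc P.dim), ContDiffAt ℝ ∞ f b ∧ ∃ (hb : b ∈ P.dom)
      (hfb : f b ∈ Q.dom), Q.toFun ⟨f b, hfb⟩ = P.toFun ⟨b, hb⟩) :
    IsGermHom P.translate Q.translate
      (fun b : Euc P.dim ↦ f (b + (P.pt : Euc P.dim)) - (Q.pt : Euc Q.dim)) := by
  have ht : Filter.Tendsto (fun b : Euc P.dim ↦ b + (P.pt : Euc P.dim)) (𝓝 0) (𝓝 P.pt) := by
    have := (continuous_add_const (P.pt : Euc P.dim)).tendsto 0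
    rwa [zero_add] at this
  refine ⟨?_, ?_, ?_⟩
  · filter_upwards [ht.eventually hf] with b hb
    exact (hb.1.comp b (contDiffAt_id.add contDiffAt_const)).sub contDiffAt_const
  · change f (0 + (P.pt : Euc P.dim)) - (Q.pt : Euc Q.dim) = 0
    rw [zero_add, hpt, sub_self]
  · refine (ht.eventually hf).mono fun (b : Euc P.dim) ⟨_, hb, hfb, h⟩ ↦ ?_
    have e : f (b + (P.pt : Euc P.dim)) - (Q.pt : Euc Q.dim) + (Q.pt : Euc Q.dim) =
      f (b + (P.pt : Euc P.dim)) := sub_add_cancel _ _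
    refine ⟨hb, (by rw [← e] at hfb; exact hfb), Eq.trans ?_ h⟩
    exact congrArg Q.toFun (Subtype.ext e)

theorem IsGermHom.eventually_translate {P : PlotAt x} {q : PtPlot x} {f : Euc P.dim → Euc q.dim}
    (hf : IsGermHom P.translate q f) : ∀ᶠ b in 𝓝 (P.pt : Euc P.dim),
      ContDiffAt ℝ ∞ (fun b ↦ f (b - (P.pt : Euc P.dim))) b ∧ ∃ (hb : b ∈ P.dom)
      (hfb : f (b - (P.pt : Euc P.dim)) ∈ q.dom), q.toFun ⟨_, hfb⟩ = P.toFun ⟨b, hb⟩ := by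
  have ht : Filter.Tendsto (fun b : Euc P.dim ↦ b - (P.pt : Euc P.dim)) (𝓝 P.pt) (𝓝 0) := by
    have := (continuous_sub_right (P.pt : Euc P.dim)).tendsto P.pt
    rwa [sub_self] at this
  filter_upwards [ht.eventually hf.1, ht.eventually hf.2.2] with b h₁ ⟨h₂, h₃, h₄⟩
  have e : b - (P.pt : Euc P.dim) + (P.pt : Euc P.dim) = b := sub_add_cancel _ _
  have hb : b ∈ P.dom := by
    change b - (P.pt : Euc P.dim) + (P.pt : Euc P.dim) ∈ P.dom at h₂
    rwa [e] at h₂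
  refine ⟨h₁.comp b (contDiffAt_id.sub contDiffAt_const), hb, h₃, h₄.trans ?_⟩
  exact congrArg P.toFun (Subtype.ext e)

/-- Finitely many germs are coequalized with a given one by a single germ. -/
theorem IsFilteredAt.exists_coeq (hx : IsFilteredAt x) {p q : PtPlot x} {m : ℕ}
    (f : Fin m → Euc p.dim → Euc q.dim) (g : Euc p.dim → Euc q.dim)
    (hf : ∀ j, IsGermHom p q (f j)) (hg : IsGermHom p q g) :
    ∃ (r : PtPlot x) (h : Euc q.dim → Euc r.dim), IsGermHom q r h ∧
      ∀ j, h ∘ f j =ᶠ[𝓝 0] h ∘ g := by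
  induction m with
  | zero => exact ⟨q, id, isGermHom_id q, fun j ↦ j.elim0⟩
  | succ m ih =>
    obtain ⟨r, h, hh, hfg⟩ := ih (fun j ↦ f j.succ) fun j ↦ hf j.succ
    obtain ⟨s, h', hh', hfg'⟩ := hx.2 p r _ _ (hh.comp (hf 0)) (hh.comp hg)
    refine ⟨s, h' ∘ h, hh'.comp hh, Fin.cases hfg' fun j ↦ ?_⟩
    filter_upwards [hfg j] with a ha
    exact congrArg h' ha

end

/-- In a filtered space, finitely many lifts of the germ of a plot `q` to plots factor through a
common one. -/
theorem IsFilteredSpace.exists_common_lift (hX : IsFilteredSpace X) {n m : ℕ} {q : Euc n → X}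
    (hq : IsPlot q) (a₀ : Euc n) (P : Fin m → Plot X) (u : ∀ j, Euc n → Euc (P j).dim)
    (hu : ∀ j, ∀ᶠ a in 𝓝 a₀, ContDiffAt ℝ ∞ (u j) a ∧
      ∃ h : u j a ∈ (P j).dom, (P j).toFun ⟨u j a, h⟩ = q a) :
    ∃ (r : Plot X) (w : Euc n → Euc r.dim) (f : ∀ j, Euc (P j).dim → Euc r.dim),
      (∀ᶠ a in 𝓝 a₀, ContDiffAt ℝ ∞ w a ∧ ∃ h : w a ∈ r.dom, r.toFun ⟨w a, h⟩ = q a) ∧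
      ∀ j, (∀ᶠ a in 𝓝 a₀, f j (u j a) = w a) ∧
        ∀ᶠ b in 𝓝 (u j a₀), ContDiffAt ℝ ∞ (f j) b ∧ ∃ (hb : b ∈ (P j).dom)
          (hfb : f j b ∈ r.dom), r.toFun ⟨f j b, hfb⟩ = (P j).toFun ⟨b, hb⟩ := by
  let Q : PlotAt (q a₀) := ⟨⟨n, ⊤, fun a ↦ q a, fun _ _ hc ↦ isPlot_reparam hq
    (isPlot_opens_iff.1 hc)⟩, ⟨a₀, trivial⟩, rfl⟩
  let T : Fin m → PlotAt (q a₀) := fun j ↦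
    ⟨P j, ⟨u j a₀, (hu j).self_of_nhds.2.choose⟩, (hu j).self_of_nhds.2.choose_spec⟩
  -- The plot `q` itself is included, since its germ `g₀` into `r₀` is the common reference with
  -- which all composites `g j ∘ u j` are coequalized.
  obtain ⟨r₀, hr₀⟩ := (hX (q a₀)).1 (m + 1) (Fin.cons Q.translate fun j ↦ (T j).translate)
  obtain ⟨g₀, hg₀⟩ : ∃ f, IsGermHom Q.translate r₀ f := hr₀ 0
  have hr₁ : ∀ j, ∃ f, IsGermHom (T j).translate r₀ f := fun j ↦ hr₀ j.succ
  choose g hg using hr₁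
  have hU : ∀ j, IsGermHom Q.translate (T j).translate (fun b : Euc n ↦ u j (b + a₀) - u j a₀) :=
    fun j ↦ PlotAt.isGermHom_translate Q (T j) rfl <| by
      filter_upwards [hu j] with a ⟨h₁, h₂, h₃⟩
      exact ⟨h₁, trivial, h₂, h₃⟩
  obtain ⟨r, h, hh, hcoeq⟩ := (hX (q a₀)).exists_coeq
    (fun j ↦ g j ∘ fun b : Euc n ↦ u j (b + a₀) - u j a₀) g₀ (fun j ↦ (hg j).comp (hU j)) hg₀
  refine ⟨r.toPlot, fun a ↦ h (g₀ (a - a₀)), fun j b ↦ h (g j (b - u j a₀)), ?_, fun j ↦ ⟨?_, ?_⟩⟩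
  · filter_upwards [(hh.comp hg₀).eventually_translate] with a ⟨h₁, h₂, h₃, h₄⟩
    exact ⟨h₁, h₃, h₄⟩
  · have ht : Filter.Tendsto (fun a : Euc n ↦ a - a₀) (𝓝 a₀) (𝓝 0) := by
      have := (continuous_sub_right a₀).tendsto a₀
      rwa [sub_self] at this
    filter_upwards [ht.eventually (hcoeq j)] with a ha
    change h (g j (u j (a - a₀ + a₀) - u j a₀)) = h (g₀ (a - a₀)) at ha
    rwa [sub_add_cancel] at ha
  · exact (hh.comp (hg j)).eventually_translate

/-! ### Local form of the plots of the tangent bundle -/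

theorem mk_eq_tangentTotal_iff {x : X} {t : TangentSpaceAt x} {p : Plot X} {b : p.dom}
    {v : Euc p.dim} : (⟨x, t⟩ : Σ x : X, TangentSpaceAt x) = p.tangentTotal ⟨b, v⟩ ↔
      ∃ h : p.toFun b = x, t = (⟨p, b, h⟩ : PlotAt x).tangentMap v := by
  constructor
  · intro h
    obtain rfl : x = p.toFun b := (Sigma.mk.inj h).1
    exact ⟨rfl, eq_of_heq (Sigma.mk.inj h).2⟩
  · rintro ⟨rfl, rfl⟩
    rfl

/-- The maps `Tp` are compatible with locally defined maps of plots. -/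
theorem tangentTotal_eq_of_eventually {p r : Plot X} {f : Euc p.dim → Euc r.dim} {b : Euc p.dim}
    (hf : ∀ᶠ b' in 𝓝 b, ContDiffAt ℝ ∞ f b' ∧ ∃ (hb : b' ∈ p.dom) (hfb : f b' ∈ r.dom),
      r.toFun ⟨f b', hfb⟩ = p.toFun ⟨b', hb⟩) (hb : b ∈ p.dom) (hfb : f b ∈ r.dom) (v : Euc p.dim) :
    p.tangentTotal ⟨⟨b, hb⟩, v⟩ = r.tangentTotal ⟨⟨f b, hfb⟩, fderiv ℝ f b v⟩ := by
  obtain ⟨-, _, _, h⟩ := hf.self_of_nhds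
  refine mk_eq_tangentTotal_iff.2 ⟨h, ?_⟩
  have := (PlotAt.isGermHom_translate (p.at ⟨b, hb⟩) ⟨r, ⟨f b, hfb⟩, h⟩ rfl hf).tangentMap_comp
  have hd : fderiv ℝ (fun b' : Euc p.dim ↦ f (b' + b) - f b) 0 = fderiv ℝ f b := by
    rw [fderiv_sub_const, fderiv_comp_add_right, zero_add]
  refine (LinearMap.congr_fun this v).symm.trans ?_
  change (⟨r, ⟨f b, hfb⟩, h⟩ : PlotAt (p.toFun ⟨b, hb⟩)).translate.tangentMap
    (fderiv ℝ (fun b' : Euc p.dim ↦ f (b' + b) - f b) 0 v) = _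
  rw [hd]
  rfl

/-- A map to `TX` which is locally of the form `Tp ∘ (u, v)` for a single plot `p` and smooth
maps `u` and `v`. -/
def IsLocallyTangent {n : ℕ} (c : Euc n → Σ x : X, TangentSpaceAt x) : Prop :=
  ∀ a₀, ∃ (p : Plot X) (u v : Euc n → Euc p.dim), ∀ᶠ a in 𝓝 a₀, ContDiffAt ℝ ∞ u a ∧
    ContDiffAt ℝ ∞ v a ∧ ∃ h : u a ∈ p.dom, c a = p.tangentTotal ⟨⟨u a, h⟩, v a⟩

/-- The local lifts of the `c j` are pushed to a common plot by maps `f j`. Their base points then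
agree, and the vectors are transformed by the derivatives of the `f j`. -/
theorem IsFilteredSpace.exists_common_tangent (hX : IsFilteredSpace X) {n m : ℕ} {q : Euc n → X}
    (hq : IsPlot q) {c : Fin m → ∀ a, TangentSpaceAt (q a)}
    (hc : ∀ j, IsLocallyTangent fun a ↦ ⟨q a, c j a⟩) (a₀ : Euc n) :
    ∃ (r : Plot X) (w : Euc n → Euc r.dim) (v : Fin m → Euc n → Euc r.dim), ∀ᶠ a in 𝓝 a₀,
      ContDiffAt ℝ ∞ w a ∧ (∀ j, ContDiffAt ℝ ∞ (v j) a) ∧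
      ∃ (h : w a ∈ r.dom) (hq : r.toFun ⟨w a, h⟩ = q a), ∀ j,
        c j a = (⟨r, ⟨w a, h⟩, hq⟩ : PlotAt (q a)).tangentMap (v j a) := by
  choose P u v huv using fun j ↦ hc j a₀
  obtain ⟨r, w, f, hw, hf⟩ := hX.exists_common_lift hq a₀ P u fun j ↦ by
    filter_upwards [huv j] with a ⟨h₁, _, h₂, h₃⟩
    exact ⟨h₁, h₂, (mk_eq_tangentTotal_iff.1 h₃).1⟩
  refine ⟨r, w, fun j a ↦ fderiv ℝ (f j) (u j a) (v j a), ?_⟩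
  -- The derivative is taken at `u j a` for each `a` near `a₀`, so `f j` must be a map of plots near
  -- each of these points.
  have hf' : ∀ᶠ a in 𝓝 a₀, ∀ j, ∀ᶠ b in 𝓝 (u j a), ContDiffAt ℝ ∞ (f j) b ∧
      ∃ (hb : b ∈ (P j).dom) (hfb : f j b ∈ r.dom),
        r.toFun ⟨f j b, hfb⟩ = (P j).toFun ⟨b, hb⟩ :=
    Filter.eventually_all.2 fun j ↦ (huv j).self_of_nhds.1.continuousAt.eventually
      (eventually_eventually_nhds.2 (hf j).2)
  filter_upwards [hw, hf', Filter.eventually_all.2 huv,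
    Filter.eventually_all.2 fun j ↦ (hf j).1] with a ⟨h₁, h₂, h₃⟩ h₄ h₅ h₆
  refine ⟨h₁, fun j ↦ ?_, h₂, h₃, fun j ↦ ?_⟩
  · exact (((h₄ j).self_of_nhds.1.fderiv_right (m := ∞) (by simp)).comp a (h₅ j).1).clm_apply
      (h₅ j).2.1
  · obtain ⟨-, -, hua, h₇⟩ := h₅ j
    have hfb : f j (u j a) ∈ r.dom := by rw [h₆ j]; exact h₂
    have h₈ := h₇.trans (tangentTotal_eq_of_eventually (h₄ j) hua hfb (v j a))
    have h₉ : (⟨f j (u j a), hfb⟩ : r.dom) = ⟨w a, h₂⟩ := Subtype.ext (h₆ j)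
    rw [h₉] at h₈
    exact (mk_eq_tangentTotal_iff.1 h₈).2

/-- The diffeology on `TX` whose plots are the maps which are locally of the form
`Tp ∘ (u, v)`. -/
@[reducible] def locallyTangentDiffeology (hX : IsFilteredSpace X) :
    DiffeologicalSpace (Σ x : X, TangentSpaceAt x) where
  plots n := {c : Euc n → Σ x : X, TangentSpaceAt x |
    IsPlot (fun a ↦ (c a).1) ∧ IsLocallyTangent c}
  constant_plots := fun ⟨x, t⟩ ↦ ⟨isPlot_const, fun _ ↦ by
    -- An arbitrary element of `T_x X` is a sum of vectors from several plots; filteredness makes it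
    -- come from one.
    obtain ⟨p, v, hv⟩ := (hX x).1.exists_tangentMap_eq fun _ : Fin 1 ↦ t
    refine ⟨p.toPlot, fun _ ↦ 0, fun _ ↦ v 0, .of_forall fun _ ↦
      ⟨contDiffAt_const, contDiffAt_const, p.zero_mem, mk_eq_tangentTotal_iff.2 ⟨p.map_zero, ?_⟩⟩⟩
    exact (hv 0).symm.trans (LinearMap.congr_fun p.tangentMap_toPlotAt (v 0)).symm⟩
  plot_reparam {n m c f} hc hf := ⟨isPlot_reparam hc.1 hf, fun a₀ ↦ by
    obtain ⟨p, u, v, h⟩ := hc.2 (f a₀)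
    refine ⟨p, u ∘ f, v ∘ f, ?_⟩
    filter_upwards [hf.continuous.continuousAt.eventually h] with a ⟨h₁, h₂, h₃⟩
    exact ⟨h₁.comp a hf.contDiffAt, h₂.comp a hf.contDiffAt, h₃⟩⟩
  locality {n c} hc := by
    refine ⟨DiffeologicalSpace.locality fun x ↦ ?_, fun a₀ ↦ ?_⟩
    · obtain ⟨W, hW, hx, h⟩ := hc x
      exact ⟨W, hW, hx, fun hfW hf ↦ (h hfW hf).1⟩
    · obtain ⟨W, hW, ha₀, h⟩ := hc a₀
      obtain ⟨e, he, heW, he0, het, hes⟩ := exists_univBall hW ha₀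
      obtain ⟨p, u, v, h⟩ := (h heW he).2 (e.symm a₀)
      refine ⟨p, u ∘ e.symm, v ∘ e.symm, ?_⟩
      filter_upwards [(e.continuousAt_symm het).eventually h, e.open_target.mem_nhds het]
        with a ⟨h₁, h₂, h₃, h₄⟩ ha
      have hea := hes.contDiffAt (e.open_target.mem_nhds ha)
      refine ⟨h₁.comp a hea, h₂.comp a hea, h₃, ?_⟩
      rw [Function.comp_apply, e.right_inv ha] at h₄
      exact h₄

/-- Among the bundle operations only addition needs filteredness: the two summands must first be
lifted to the same plot over the same base map. -/
theorem isVPB_locallyTangentDiffeology (hX : IsFilteredSpace X) :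
    IsVPB (fun x : X ↦ TangentSpaceAt x) (locallyTangentDiffeology hX) := by
  refine @IsVPB.mk _ _ _ _ _ _ (fun n c hc ↦ hc.1) (fun q s t hs ht ↦ ⟨hs.1, fun a₀ ↦ ?_⟩)
    (fun q r s hr hs ↦ ⟨hs.1, fun a₀ ↦ ?_⟩) (fun n q hq ↦ ⟨hq, fun a₀ ↦ ?_⟩)
  · obtain ⟨p, w, v, h⟩ := hX.exists_common_tangent hs.1 (c := ![s, t])
      (Fin.forall_fin_two.2 ⟨hs.2, ht.2⟩) a₀
    refine ⟨p, w, v 0 + v 1, ?_⟩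
    filter_upwards [h] with a ⟨h₁, h₂, h₃, h₄, h₅⟩
    refine ⟨h₁, (h₂ 0).add (h₂ 1), h₃, mk_eq_tangentTotal_iff.2 ⟨h₄, ?_⟩⟩
    exact (congrArg₂ (· + ·) (h₅ 0) (h₅ 1)).trans (map_add _ _ _).symm
  · obtain ⟨p, u, v, h⟩ := hs.2 a₀
    refine ⟨p, u, fun a ↦ r a • v a, ?_⟩
    filter_upwards [h] with a ⟨h₁, h₂, h₃, h₄⟩
    obtain ⟨h₅, h₆⟩ := mk_eq_tangentTotal_iff.1 h₄
    refine ⟨h₁, (isPlot_iff_contDiff.1 hr).contDiffAt.smul h₂, h₃,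
      mk_eq_tangentTotal_iff.2 ⟨h₅, ?_⟩⟩
    exact (congrArg (r a • ·) h₆).trans (map_smul _ _ _).symm
  · refine ⟨⟨n, ⊤, fun a ↦ q a, fun _ _ hc ↦ isPlot_reparam hq (isPlot_opens_iff.1 hc)⟩,
      id, fun _ ↦ 0, .of_forall fun a ↦ ⟨contDiffAt_id, contDiffAt_const, trivial,
        mk_eq_tangentTotal_iff.2 ⟨rfl, (map_zero _).symm⟩⟩⟩

/-- The locally tangent maps contain the generators `Tp` and already form a pseudo-bundle
diffeology, so they contain the dvsification. -/
theorem IsFilteredSpace.isLocallyTangent (hX : IsFilteredSpace X) {n : ℕ}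
    {c : Euc n → (tangentBundle X).Total} (hc : IsPlot c) : IsLocallyTangent c := by
  have hle : generatedDiffeology (fun p : Plot X ↦ p.tangentTotal) ≤
      locallyTangentDiffeology hX := by
    rw [generatedDiffeology, DiffeologicalSpace.generateFrom_le_iff]
    rintro n c ⟨p, r, hr, hcr⟩
    have hc : c = p.tangentTotal ∘ r := hcr
    rw [hc]
    obtain ⟨h₁, h₂⟩ := isPlot_opensTangent_iff.1 hr
    exact ⟨p.smooth _ _ ((opensTangent p.dom).isVPB.proj _ r hr), fun a₀ ↦
      ⟨p, fun a ↦ (r a).1, fun a ↦ (r a).2, .of_forall fun a ↦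
        ⟨h₁.contDiffAt, h₂.contDiffAt, (r a).1.2, rfl⟩⟩⟩
  exact (DiffeologicalSpace.le_iff'.1
    (dvsify_le _ hle (isVPB_locallyTangentDiffeology hX)) n c hc).2

/-! ### The comparison map is an isomorphism -/

theorem dSmooth_tangentTotal (p : Plot X) : DSmooth (fun z : (opensTangent p.dom).Total ↦
    (tangentBundle X).elt (p.toFun z.1) ((p.at z.1).tangentMap z.2)) := fun n c hc ↦
  DiffeologicalSpace.le_iff'.1 (le_dvsify _ _) n _
    (DiffeologicalSpace.isPlot_generatedFrom_of_mem ⟨p, c, hc, rfl⟩)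

theorem dSmooth_exterior_tangentMap (k : ℕ) (p : Plot X) :
    DSmooth (fun z : ((opensTangent p.dom).exterior k).Total ↦
      ((tangentBundle X).exterior k).elt (p.toFun z.1)
        (exteriorPower.map k (p.at z.1).tangentMap z.2)) :=
  (opensTangent p.dom).dSmooth_exterior_map k (tangentBundle X) p.smooth
    (fun a ↦ (p.at a).tangentMap) (dSmooth_tangentTotal p)

/-- A fibrewise linear map out of `T^k X` is smooth as soon as its composites with the maps
`Λᵏ TU → T^k X` are. -/
theorem dSmooth_formBundle {B' : Type w} [DiffeologicalSpace B'] {k : ℕ} (C : VPB.{w, z} B')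
    {g : X → B'} (hg : DSmooth g) (H : VPB.FibreMap (formBundle X k) g C)
    (h : ∀ p : Plot X, VPB.FibreMap ((opensTangent p.dom).exterior k) (fun a ↦ g (p.toFun a)) C)
    (hH : ∀ (p : Plot X) a w, H (p.toFun a) (p.toFormSpace k a w) = h p a w)
    (hs : ∀ p : Plot X, DSmooth (fun z : ((opensTangent p.dom).exterior k).Total ↦
      C.elt (g (p.toFun z.1)) (h p z.1 z.2))) :
    DSmooth (fun z : (formBundle X k).Total ↦ C.elt (g z.1) (H z.1 z.2)) := by
  refine dSmooth_dvsify_generated (fun p : Plot X ↦ p.formTotal k) (fun p m c hc ↦ ?_)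
    C hg H fun p m c hc ↦ ?_
  · exact p.smooth _ _ (((opensTangent p.dom).exterior k).isVPB.proj _ c hc)
  · exact IsPlot.congr (hs p m c hc) fun a ↦ congrArg (C.elt _) (hH p (c a).1 (c a).2).symm

/-- The comparison map `ρ` as a fibrewise linear map of bundles. -/
def rhoMap (k : ℕ) : VPB.FibreMap (formBundle X k) id ((tangentBundle X).exterior k) :=
  fun x ↦
    { toFun := rho k x
      map_add' := map_add (rho k x)
      map_smul' := map_smul (rho k x) }

/-- The map `Λᵏ Tp : Λᵏ TU → Λᵏ T^dvs X` as a fibrewise linear map of bundles. -/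
def Plot.exteriorTangentMap (k : ℕ) (p : Plot X) :
    VPB.FibreMap ((opensTangent p.dom).exterior k) p.toFun ((tangentBundle X).exterior k) :=
  fun a ↦ exteriorPower.map k (p.at a).tangentMap

theorem rhoMap_toFormSpace (k : ℕ) (p : Plot X) (a : p.dom) (w : ⋀[ℝ]^k (Euc p.dim)) :
    rhoMap k (p.toFun a) (p.toFormSpace k a w) = p.exteriorTangentMap k a w :=
  rho_toFormSpace k p a w

theorem dSmooth_rhoMap (k : ℕ) : DSmooth (fun z : (formBundle X k).Total ↦
    ((tangentBundle X).exterior k).elt z.1 (rhoMap k z.1 z.2)) :=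
  dSmooth_formBundle ((tangentBundle X).exterior k) (g := id) (fun _ _ hp ↦ hp) (rhoMap k)
    (Plot.exteriorTangentMap k) (rhoMap_toFormSpace k) (dSmooth_exterior_tangentMap k)

/-- A fibrewise linear map out of the tangent bundle is smooth as soon as its composites with the
maps `Tp` are. -/
theorem dSmooth_tangentBundle {B' : Type w} [DiffeologicalSpace B'] (C : VPB.{w, z} B')
    {g : X → B'} (hg : DSmooth g) (H : VPB.FibreMap (tangentBundle X) g C)
    (h : ∀ (p : Plot X) (a : p.dom), Euc p.dim → C.fib (g (p.toFun a)))
    (hH : ∀ (p : Plot X) a v, H (p.toFun a) ((p.at a).tangentMap v) = h p a v)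
    (hs : ∀ p : Plot X, DSmooth (fun z : (opensTangent p.dom).Total ↦
      C.elt (g (p.toFun z.1)) (h p z.1 z.2))) :
    DSmooth (fun z : (tangentBundle X).Total ↦ C.elt (g z.1) (H z.1 z.2)) := by
  refine dSmooth_dvsify_generated (fun p : Plot X ↦ p.tangentTotal) (fun p m c hc ↦ ?_)
    C hg H fun p m c hc ↦ ?_
  · exact p.smooth _ _ ((opensTangent p.dom).isVPB.proj _ c hc)
  · exact IsPlot.congr (hs p m c hc) fun a ↦ congrArg (C.elt _) (hH p (c a).1 (c a).2).symm

theorem rho_of {k : ℕ} {x : X} (P : PlotAt x) (w : ⋀[ℝ]^k (Euc P.dim)) :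
    rho k x (VectColim.of (fun P : PlotAt x ↦ ⋀[ℝ]^k (Euc P.dim)) (formArrows k) P w) =
      exteriorPower.map k P.tangentMap w :=
  VectColim.desc_of (M := fun P : PlotAt x ↦ ⋀[ℝ]^k (Euc P.dim)) (A := formArrows k)
    (fun P : PlotAt x ↦ exteriorPower.map k P.tangentMap) _ P w

theorem elt_of {k : ℕ} {x : X} (P : PlotAt x) (w : ⋀[ℝ]^k (Euc P.dim)) :
    (formBundle X k).elt x
      (VectColim.of (fun P : PlotAt x ↦ ⋀[ℝ]^k (Euc P.dim)) (formArrows k) P w) =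
    (formBundle X k).elt (P.toFun P.pt) (P.toPlot.toFormSpace k P.pt w) := by
  obtain ⟨p, a, rfl⟩ := P
  rfl

variable {k : ℕ} {g : VPB.FibreMap ((tangentBundle X).exterior k) id (formBundle X k)}

/-- If a family of vectors over a plot of `X` is locally induced from a single plot, then its wedge
product defines a plot of `T^k X`. -/
theorem isPlot_of_locally_tangent (hg : ∀ x, Function.LeftInverse (g x) (rho k x)) {n : ℕ}
    {y : Euc n → (tangentBundle X).FibreProd k}
    (hy : ∀ a₀, ∃ (r : Plot X) (w : Euc n → Euc r.dim) (v : Fin k → Euc n → Euc r.dim),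
      ∀ᶠ a in 𝓝 a₀, ContDiffAt ℝ ∞ w a ∧ (∀ j, ContDiffAt ℝ ∞ (v j) a) ∧
      ∃ (h : w a ∈ r.dom) (hq : r.toFun ⟨w a, h⟩ = (y a).1), ∀ j,
        (y a).2 j = (⟨r, ⟨w a, h⟩, hq⟩ : PlotAt (y a).1).tangentMap (v j a)) :
    IsPlot (fun a ↦ (formBundle X k).elt (y a).1 (g _ (exteriorPower.ιMulti ℝ k (y a).2))) := by
  refine DiffeologicalSpace.locality fun a₀ ↦ ?_
  obtain ⟨r, w, v, h⟩ := hy a₀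
  obtain ⟨W, hW, hWo, ha₀⟩ := eventually_nhds_iff.1 h
  refine ⟨W, hWo, ha₀, fun {m f} hfW hf ↦ ?_⟩
  have hw : ContDiff ℝ ∞ (fun a ↦ w (f a)) :=
    contDiff_iff_contDiffAt.2 fun a ↦ (hW _ (hfW a)).1.comp a hf.contDiffAt
  have hv : ∀ j, ContDiff ℝ ∞ (fun a ↦ v j (f a)) := fun j ↦
    contDiff_iff_contDiffAt.2 fun a ↦ ((hW _ (hfW a)).2.1 j).comp a hf.contDiffAt
  choose _ _ hwr hq hyv using hW
  have hc : IsPlot fun a ↦ (⟨w (f a), hwr _ (hfW a)⟩ : r.dom) := isPlot_opens_iff.2 hw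
  have hplot := dSmooth_toFormSpace k r m _ <| (opensTangent r.dom).dSmooth_wedge k m
    (fun a ↦ ⟨⟨w (f a), hwr _ (hfW a)⟩, fun j ↦ v j (f a)⟩)
    ((opensTangent r.dom).isPlot_fibreProd_iff.2 ⟨hc, fun j ↦
      isPlot_opensTangent_iff.2 ⟨hw, hv j⟩⟩)
  refine IsPlot.congr hplot fun a ↦ ?_
  have h₁ := elt_of (k := k) ⟨r, ⟨w (f a), hwr _ (hfW a)⟩, hq _ (hfW a)⟩
    (exteriorPower.ιMulti ℝ k fun j ↦ v j (f a))
  refine h₁.symm.trans (congrArg ((formBundle X k).elt _) ?_)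
  -- As `g` is a left inverse of `ρ`, it suffices to see that `ρ` sends the lifted wedge to the
  -- wedge of the `y j`.
  refine (hg _ _).symm.trans (congrArg (g _) ?_)
  rw [rho_of, exteriorPower.map_apply_ιMulti]
  exact congrArg (exteriorPower.ιMulti ℝ k) (funext fun j ↦ (hyv _ (hfW a) j).symm)

/-- With no vectors to lift, the base map itself serves as the common plot. -/
theorem dSmooth_inverse_zero {g : VPB.FibreMap ((tangentBundle X).exterior 0) id (formBundle X 0)}
    (hg : ∀ x, Function.LeftInverse (g x) (rho 0 x)) :
    DSmooth (fun z : ((tangentBundle X).exterior 0).Total ↦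
      (formBundle X 0).elt z.1 (g z.1 z.2)) := by
  refine (tangentBundle X).dSmooth_exterior 0 (formBundle X 0) (g := id) (fun _ _ hp ↦ hp) g
    fun n y hy ↦ isPlot_of_locally_tangent hg fun a₀ ↦ ?_
  have h₁ := ((tangentBundle X).isPlot_fibreProd_iff.1 hy).1
  exact ⟨⟨n, ⊤, fun a ↦ (y a).1, fun _ _ hc ↦ isPlot_reparam h₁ (isPlot_opens_iff.1 hc)⟩, id,
    fun _ _ ↦ 0, .of_forall fun a ↦
      ⟨contDiffAt_id, fun _ ↦ contDiffAt_const, trivial, rfl, fun j ↦ j.elim0⟩⟩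

set_option maxHeartbeats 800000 in
theorem exteriorOne_tangentMap (p : Plot X) (a : p.dom) (v : Euc p.dim) :
    (tangentBundle X).exteriorOne (p.toFun a) ((p.at a).tangentMap v) =
      rho 1 (p.toFun a) (p.toFormSpace 1 a (exteriorPower.ιMulti ℝ 1 fun _ ↦ v)) := by
  rw [rho_toFormSpace]
  refine ((tangentBundle X).exteriorOne_apply _ _).trans ?_
  exact (exteriorPower.map_apply_ιMulti (p.at a).tangentMap fun _ ↦ v).symm

/-- Smoothness is tested on the generators `Tp`, where the inverse is the smooth map `TU = Λ¹ TU →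
T¹ X`; no two plots have to be compared. -/
theorem dSmooth_inverse_one {g : VPB.FibreMap ((tangentBundle X).exterior 1) id (formBundle X 1)}
    (hg : ∀ x, Function.LeftInverse (g x) (rho 1 x)) :
    DSmooth (fun z : ((tangentBundle X).exterior 1).Total ↦
      (formBundle X 1).elt z.1 (g z.1 z.2)) := by
  refine (tangentBundle X).dSmooth_exterior_one (formBundle X 1) (g := id) (fun _ _ hp ↦ hp) g ?_
  refine dSmooth_tangentBundle (formBundle X 1) (g := id) (fun _ _ hp ↦ hp)
    (fun x ↦ g x ∘ₗ (tangentBundle X).exteriorOne x)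
    (fun p a v ↦ p.toFormSpace 1 a (exteriorPower.ιMulti ℝ 1 fun _ ↦ v)) (fun p a v ↦ ?_)
    fun p n c hc ↦ ?_
  · exact Eq.trans (congrArg (g _) (exteriorOne_tangentMap p a v)) (hg _ _)
  · exact dSmooth_toFormSpace 1 p n _ <| (opensTangent p.dom).dSmooth_wedge 1 n
      (fun a ↦ ⟨(c a).1, fun _ ↦ (c a).2⟩) ((opensTangent p.dom).isPlot_fibreProd_iff.2
        ⟨(opensTangent p.dom).isVPB.proj _ c hc, fun _ ↦ hc⟩)

theorem IsFilteredSpace.dSmooth_inverse (hX : IsFilteredSpace X)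
    (hg : ∀ x, Function.LeftInverse (g x) (rho k x)) :
    DSmooth (fun z : ((tangentBundle X).exterior k).Total ↦
      (formBundle X k).elt z.1 (g z.1 z.2)) := by
  refine (tangentBundle X).dSmooth_exterior k (formBundle X k) (g := id) (fun _ _ hp ↦ hp) g
    fun n y hy ↦ isPlot_of_locally_tangent hg fun a₀ ↦ ?_
  obtain ⟨h₁, h₂⟩ := (tangentBundle X).isPlot_fibreProd_iff.1 hy
  exact hX.exists_common_tangent h₁ (fun j ↦ hX.isLocallyTangent (h₂ j)) a₀

set_option maxHeartbeats 2000000 in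
/-- The comparison map is an isomorphism of bundles in degrees at most `1` and for filtered
spaces. -/
theorem isBundleIso_rho (k : ℕ) (h : k = 0 ∨ k = 1 ∨ IsFilteredSpace X) :
    VPB.IsBundleIso (E := formBundle X k) (E' := (tangentBundle X).exterior k) (rho k) := by
  have hbij : ∀ x : X, Function.Bijective (rho k x) := by
    rcases h with rfl | rfl | hX
    · exact bijective_rho_zero
    · exact bijective_rho_one
    · exact fun x ↦ (hX x).bijective_rho k
  have hinv : ∀ g : VPB.FibreMap ((tangentBundle X).exterior k) id (formBundle X k),
      (∀ x, Function.LeftInverse (g x) (rho k x)) →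
      DSmooth (fun z : ((tangentBundle X).exterior k).Total ↦
        (formBundle X k).elt z.1 (g z.1 z.2)) := by
    rcases h with rfl | rfl | hX
    · exact fun _ ↦ dSmooth_inverse_zero
    · exact fun _ ↦ dSmooth_inverse_one
    · exact fun _ ↦ hX.dSmooth_inverse
  have key := VPB.isBundleIso_of_bijective (rhoMap k) hbij (dSmooth_rhoMap k) hinv
  exact key

end LocalForm

end DVPB

end

/-! ### The theorem -/

theorem theorem4p5 {X : Type*} [DiffeologicalSpace X] (k : ℕ)
    (h : k = 0 ∨ k = 1 ∨ DVPB.IsFilteredSpace X) :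
    DVPB.VPB.IsBundleIso (E := DVPB.formBundle X k) (E' := (DVPB.tangentBundle X).exterior k)
      (DVPB.rho k) ∧
    (∃ R : ((DVPB.tangentBundle X).exterior k).dual.sections ≃ₗ[ℝ]
        (DVPB.formBundle X k).dual.sections,
      Diffeology.DSmooth R ∧ Diffeology.DSmooth R.symm ∧
      ∀ s (x : X) (t : (DVPB.formBundle X k).fib x),
        ((R s).1 x).1 t = (s.1 x).1 (DVPB.rho k x t)) ∧
    ∃ Φ : ((DVPB.tangentBundle X).exterior k).dual.sections ≃ₗ[ℝ] DVPB.forms X k,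
      Diffeology.DSmooth Φ ∧ Diffeology.DSmooth Φ.symm ∧
      ∀ s (p : DVPB.Plot X) (a : p.dom) (v : Fin k → DVPB.Euc p.dim),
        (Φ s).1 p a v = (s.1 (p.toFun a)).1
          (DVPB.rho k (p.toFun a) (p.toFormSpace k a (exteriorPower.ιMulti ℝ k v))) := by
  have hρ := DVPB.isBundleIso_rho (X := X) k h
  obtain ⟨R, hR, hR', hRs⟩ := hρ.exists_dualSectionsEquiv
  refine ⟨hρ, ⟨R, hR, hR', hRs⟩, R.trans DVPB.sectionsEquivForms, fun n σ hσ ↦ ?_, fun n σ hσ ↦ ?_,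
    fun s p a v ↦ ?_⟩
  · exact DVPB.dSmooth_sectionsToForms n _ (hR n σ hσ)
  · exact hR' n _ (DVPB.dSmooth_formsToSections n σ hσ)
  -- By definition `sectionForm` evaluates the section on the image of the wedge in `T^k X`, so the
  -- formula for `R` is the required one.
  · exact hRs s _ _
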